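/- Conventions. A \emph{distribution} $\Delta\subset TM$ on a smooth (finite-dimensional, Hausdorff) manifold is a smooth subbundle. Its weak derived flag is given by the modules of sections $\Gamma(\Delta_1)=\Gamma(\Delta)$, $\Gamma(\Delta_{i+1})=\Gamma(\Delta_i)+[\Gamma(\Delta),\Gamma(\Delta_i)]$ (with $\Delta_0=0$); $\Delta_i(x)\subset T_xM$ is the space of values at $x$ of the fields in $\Gamma(\Delta_i)$. $\Delta$ is \emph{regular} if the dimension of $\Delta_i(x)$ does not depend on $x$ for every $i$, and \emph{completely non-holonomic} if $\Delta_r=TM$ for some $r$. The \emph{Carnot algebra} of a regular $\Delta$ at $x$ is the graded Lie algebra $\mathfrak m=\bigoplus_{i\ge1}g_{-i}$, $g_{-i}=\Delta_i(x)/\Delta_{i-1}(x)$ (equivalently, the fibre at $x$ of $\bigoplus_i\Gamma(\Delta_i)/\Gamma(\Delta_{i-1})$), with the bracket induced by the commutator of vector fields. An \emph{integrable extension} $\pi:(\tilde M,\tilde\Delta)\to(M,\Delta)$ is a smooth submersion $\pi:\tilde M\to M$ such that for every $x\in\tilde M$ the differential $d_x\pi$ restricts to an isomorphism $\tilde\Delta(x)\to\Delta(\pi(x))$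 and $\tilde\Delta_2(x)\cap\operatorname{Ker}d_x\pi=0$. When $\Delta$ is completely non-holonomic, it is called \emph{non-trivial} if $\tilde\Delta$ is completely non-holonomic as well. A GNLA is a finite-dimensional real Lie algebra with a grading $\mathfrak m=\bigoplus_{i\ge1}g_{-i}$, $[g_{-i},g_{-j}]\subset g_{-i-j}$ (it is automatically nilpotent); it is \emph{fundamental} if $g_{-1}$ generates it. For graded Lie algebras $\tilde{\mathfrak m},\mathfrak m$ as above, a $d$-dimensional \emph{central extension of pure grading} $-k$ is an exact sequence $0\to\mathfrak a\to\tilde{\mathfrak m}\xrightarrow{\varpi}\mathfrak m\to0$ in which $\varpi$ is a homomorphism of graded Lie algebras, and $\mathfrak a$ is $d$-dimensional, central and contained in the component $\tilde g_{-k}$; it is \emph{nontrivial} if the sequence of Lie algebras does not split. The \emph{flat model} of a GNLA $\mathfrak m$ is the simply connected Lie group with Lie algebra $\mathfrak m$, with the left-invariant distribution spanned by the left-invariant vector fields in $g_{-1}$. Theorem. 1. Let $\pi:(\tilde M,\tilde\Delta)\to(M,\Delta)$ be a non-trivial integrable extension of regular, completely non-holonomic distributions. Let $x\in\tilde M$ and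 $d=\dim\operatorname{Ker}d_x\pi$. Suppose that the tangent space $\mathfrak v=\operatorname{Ker}d_x\pi$ of the fibre has pure grading $-k$ with $k>2$, i.e. $\mathfrak v\subset\tilde\Delta_k(x)$ and $\mathfrak v\cap\tilde\Delta_{k-1}(x)=0$. Then the Carnot algebra $\tilde{\mathfrak m}$ of $\tilde\Delta$ at $x$ is a $d$-dimensional central extension, of pure grading $-k$, of the Carnot algebra $\mathfrak m$ of $\Delta$ at $\pi(x)$; the projection $\tilde{\mathfrak m}\to\mathfrak m$ can be taken to be the map induced by $d_x\pi$. 2. Conversely, let $\varpi:\tilde{\mathfrak m}\to\mathfrak m$ be a nontrivial $d$-dimensional central extension of pure grading $-k$, $k>2$, of GNLAs, with $\mathfrak m$ fundamental, and let $(\tilde M,\tilde\Delta)$ and $(M,\Delta)$ be the flat models of $\tilde{\mathfrak m}$ and $\mathfrak m$. Then there is an integrable extension $\pi:(\tilde M,\tilde\Delta)\to(M,\Delta)$; it can be taken to be a homomorphism of Lie groups whose differential maps the left-invariant field of each $X\in\tilde{\mathfrak m}$ to that of $\varpi(X)$. If $\tilde{\mathfrak m}$ is fundamental too, then $\tilde\Delta$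 is completely non-holonomic. -/

import Mathlib

open scoped Manifold ContDiff DirectSum

noncomputable section

section VectorFields

variable (E : Type*) [NormedAddCommGroup E] [NormedSpace ℝ E]
  (M : Type*) [TopologicalSpace M] [ChartedSpace E M] [IsManifold 𝓘(ℝ, E) ∞ M]

/-- The real vector space of smooth (`C^∞`) vector fields on `M`. -/
def SmoothVF : Submodule ℝ (∀ x : M, TangentSpace 𝓘(ℝ, E) x) where
  carrier := {X | ContMDiff 𝓘(ℝ, E) 𝓘(ℝ, E).tangent ∞
    (fun x => (⟨x, X x⟩ : TangentBundle 𝓘(ℝ, E) M))}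
  add_mem' hX hY := hX.add_section hY
  zero_mem' := Bundle.contMDiff_zeroSection ℝ (TangentSpace 𝓘(ℝ, E) : M → Type _)
  smul_mem' c _ hX := hX.const_smul_section (a := c)

variable {E M}

theorem SmoothVF.contMDiff (X : SmoothVF E M) : ContMDiff 𝓘(ℝ, E) 𝓘(ℝ, E).tangent ∞
    (fun x => (⟨x, X.1 x⟩ : TangentBundle 𝓘(ℝ, E) M)) := X.2

theorem SmoothVF.mdifferentiableAt (X : SmoothVF E M) (x : M) :
    MDifferentiableAt 𝓘(ℝ, E) 𝓘(ℝ, E).tangent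
    (fun x => (⟨x, X.1 x⟩ : TangentBundle 𝓘(ℝ, E) M)) x :=
  (SmoothVF.contMDiff X x).mdifferentiableAt (by simp)

/-- The product of a smooth function and a smooth vector field. -/
def SmoothVF.fsmul (f : C^∞⟮𝓘(ℝ, E), M; ℝ⟯) (X : SmoothVF E M) : SmoothVF E M :=
  ⟨fun x => f x • X.1 x, f.contMDiff.smul_section (SmoothVF.contMDiff X)⟩

/-- The derivative `X f` of a smooth function along a smooth vector field. -/
def SmoothVF.deriv (X : SmoothVF E M) (f : C^∞⟮𝓘(ℝ, E), M; ℝ⟯) : C^∞⟮𝓘(ℝ, E), M; ℝ⟯ :=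
  ⟨fun x => mvfderiv 𝓘(ℝ, E) f x (X.1 x), by
    have h1 : ContMDiff 𝓘(ℝ, E).tangent 𝓘(ℝ, ℝ).tangent ∞ (tangentMap 𝓘(ℝ, E) 𝓘(ℝ, ℝ) f) :=
      f.contMDiff.contMDiff_tangentMap (by simp)
    exact (contMDiff_snd_tangentBundle_modelSpace ℝ 𝓘(ℝ, ℝ)).comp (h1.comp (SmoothVF.contMDiff X))⟩

variable [FiniteDimensional ℝ E]

/-- The commutator of smooth vector fields. -/
instance : Bracket (SmoothVF E M) (SmoothVF E M) where
  bracket X Y := ⟨VectorField.mlieBracket 𝓘(ℝ, E) X.1 Y.1, by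
    have : CompleteSpace E := FiniteDimensional.complete ℝ E
    have : IsManifold 𝓘(ℝ, E) (((⊤ : ℕ∞) : WithTop ℕ∞) + 1) M := by
      simpa using (inferInstance : IsManifold 𝓘(ℝ, E) ∞ M)
    have : IsManifold 𝓘(ℝ, E) (minSmoothness ℝ 2) M := by
      simpa using (inferInstance : IsManifold 𝓘(ℝ, E) 2 M)
    exact ContDiff.mlieBracket_vectorField (m := ⊤) (n := ⊤) X.2 Y.2 (by simp)⟩

theorem SmoothVF.lie_apply (X Y : SmoothVF E M) (x : M) :
    (⁅X, Y⁆ : SmoothVF E M).1 x = VectorField.mlieBracket 𝓘(ℝ, E) X.1 Y.1 x := rfl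

instance : LieRing (SmoothVF E M) where
  add_lie X Y Z := by
    have : CompleteSpace E := FiniteDimensional.complete ℝ E
    ext x; exact VectorField.mlieBracket_add_left (SmoothVF.mdifferentiableAt X x) (SmoothVF.mdifferentiableAt Y x)
  lie_add X Y Z := by
    have : CompleteSpace E := FiniteDimensional.complete ℝ E
    ext x; exact VectorField.mlieBracket_add_right (SmoothVF.mdifferentiableAt Y x) (SmoothVF.mdifferentiableAt Z x)
  lie_self X := by
    ext x; simp [SmoothVF.lie_apply]
  leibniz_lie X Y Z := by
    have : CompleteSpace E := FiniteDimensional.complete ℝ E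
    have : IsManifold 𝓘(ℝ, E) (minSmoothness ℝ 3) M := by
      simpa using (inferInstance : IsManifold 𝓘(ℝ, E) 3 M)
    have le2 : minSmoothness ℝ 2 ≤ ∞ := by
      simpa using (ENat.LEInfty.out : (2 : WithTop ℕ∞) ≤ ∞)
    ext x
    exact VectorField.leibniz_identity_mlieBracket_apply
      ((SmoothVF.contMDiff X x).of_le le2) ((SmoothVF.contMDiff Y x).of_le le2)
      ((SmoothVF.contMDiff Z x).of_le le2)

instance : LieAlgebra ℝ (SmoothVF E M) where
  lie_smul c X Y := by
    have : CompleteSpace E := FiniteDimensional.complete ℝ E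
    ext x; exact VectorField.mlieBracket_const_smul_right (SmoothVF.mdifferentiableAt Y x)

theorem SmoothVF.lie_fsmul (X Y : SmoothVF E M) (f : C^∞⟮𝓘(ℝ, E), M; ℝ⟯) :
    ⁅X, SmoothVF.fsmul f Y⁆ = SmoothVF.fsmul (SmoothVF.deriv X f) Y + SmoothVF.fsmul f ⁅X, Y⁆ := by
  have : CompleteSpace E := FiniteDimensional.complete ℝ E
  ext x
  exact VectorField.mlieBracket_smul_right
    ((f.contMDiff x).mdifferentiableAt (by simp)) (SmoothVF.mdifferentiableAt Y x)


variable (E M) in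
/-- A (smooth, constant rank) distribution on `M`: subspaces `Δ x ⊆ T_x M` of one dimension, such
that every vector of `Δ x` extends to a smooth vector field tangent to `Δ`. -/
structure TangentDistribution where
  /-- the subspace of `T_x M` -/
  space : ∀ x : M, Submodule ℝ (TangentSpace 𝓘(ℝ, E) x)
  finrank_eq : ∀ x y, Module.finrank ℝ (space x) = Module.finrank ℝ (space y)
  exists_section : ∀ x, ∀ v ∈ space x, ∃ X : SmoothVF E M, (∀ y, X.1 y ∈ space y) ∧ X.1 x = v

namespace TangentDistribution

variable (Δ : TangentDistribution E M)

/-- The module `Γ(Δ)` of smooth sections of `Δ`. -/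
def sections : Submodule ℝ (SmoothVF E M) where
  carrier := {X | ∀ y, X.1 y ∈ Δ.space y}
  add_mem' hX hY y := (Δ.space y).add_mem (hX y) (hY y)
  zero_mem' y := (Δ.space y).zero_mem
  smul_mem' c _ hX y := (Δ.space y).smul_mem c (hX y)

/-- The modules `Γ(Δ_i)` of the weak derived flag: `Γ(Δ_1) = Γ(Δ)` and
`Γ(Δ_{i+1}) = Γ(Δ_i) + [Γ(Δ), Γ(Δ_i)]`; by convention `Γ(Δ_0) = 0`. -/
def flagSections : ℕ → Submodule ℝ (SmoothVF E M)
  | 0 => ⊥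
  | 1 => Δ.sections
  | n + 2 => flagSections (n + 1) ⊔
      Submodule.span ℝ {Z | ∃ X ∈ Δ.sections, ∃ Y ∈ flagSections (n + 1), Z = ⁅X, Y⁆}

/-- The subspace `Δ_i(x)` of `T_x M`: the values at `x` of the fields in `Γ(Δ_i)`. -/
def flag (i : ℕ) (x : M) : Submodule ℝ (TangentSpace 𝓘(ℝ, E) x) :=
  ((Δ.flagSections i).map (SmoothVF E M).subtype).map (LinearMap.proj x)

/-- `Δ` is regular: the terms of the weak derived flag have constant rank. -/
def IsRegular : Prop :=
  ∀ i x y, Module.finrank ℝ (Δ.flag i x) = Module.finrank ℝ (Δ.flag i y)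

/-- `Δ` is completely non-holonomic: `Δ_k = TM` for some `k`. -/
def IsCompletelyNonholonomic : Prop :=
  ∃ k, ∀ x, Δ.flag k x = ⊤

theorem flagSections_le_succ (n : ℕ) : Δ.flagSections n ≤ Δ.flagSections (n + 1) := by
  rcases n with _ | n
  · exact bot_le
  · exact le_sup_left

theorem flagSections_mono : Monotone Δ.flagSections :=
  monotone_nat_of_le_succ Δ.flagSections_le_succ

theorem lie_sections_mem {n : ℕ} {X Y : SmoothVF E M} (hX : X ∈ Δ.sections)
    (hY : Y ∈ Δ.flagSections n) : ⁅X, Y⁆ ∈ Δ.flagSections (n + 1) := by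
  rcases n with _ | n
  · obtain rfl : Y = 0 := by simpa [flagSections] using hY
    simp
  · exact Submodule.mem_sup_right (Submodule.subset_span ⟨X, hX, Y, hY, rfl⟩)

theorem fsmul_mem_sections (f : C^∞⟮𝓘(ℝ, E), M; ℝ⟯) {X : SmoothVF E M} (hX : X ∈ Δ.sections) :
    SmoothVF.fsmul f X ∈ Δ.sections :=
  fun y => (Δ.space y).smul_mem _ (hX y)

variable (E M) in
/-- Multiplication by a smooth function as a linear map on vector fields. -/
def _root_.SmoothVF.fsmulₗ (f : C^∞⟮𝓘(ℝ, E), M; ℝ⟯) : SmoothVF E M →ₗ[ℝ] SmoothVF E M where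
  toFun := SmoothVF.fsmul f
  map_add' X Y := by ext x; exact smul_add _ _ _
  map_smul' c X := by ext x; exact smul_comm _ _ _

theorem fsmul_mem (n : ℕ) (f : C^∞⟮𝓘(ℝ, E), M; ℝ⟯) {X : SmoothVF E M}
    (hX : X ∈ Δ.flagSections n) : SmoothVF.fsmul f X ∈ Δ.flagSections n := by
  induction n generalizing f X with
  | zero =>
    obtain rfl : X = 0 := by simpa [flagSections] using hX
    have h : SmoothVF.fsmul f (0 : SmoothVF E M) = 0 := (SmoothVF.fsmulₗ E M f).map_zero
    rw [h]; exact Submodule.zero_mem _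
  | succ n ih =>
    rcases n with _ | n
    · exact Δ.fsmul_mem_sections f hX
    · have key : Δ.flagSections (n + 2) ≤
          (Δ.flagSections (n + 2)).comap (SmoothVF.fsmulₗ E M f) := by
        refine sup_le (fun Y hY => Submodule.mem_sup_left (ih f hY)) (Submodule.span_le.2 ?_)
        rintro _ ⟨Y, hY, Z, hZ, rfl⟩
        have h1 : SmoothVF.fsmul f ⁅Y, Z⁆ =
            ⁅Y, SmoothVF.fsmul f Z⁆ - SmoothVF.fsmul (SmoothVF.deriv Y f) Z := by
          rw [SmoothVF.lie_fsmul]; abel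
        change SmoothVF.fsmul f ⁅Y, Z⁆ ∈ Δ.flagSections (n + 2)
        rw [h1]
        exact Submodule.sub_mem _ (Δ.lie_sections_mem hY (ih f hZ))
          (Δ.flagSections_le_succ _ (ih _ hZ))
      exact key hX

theorem lie_mem {i j : ℕ} {X Y : SmoothVF E M} (hX : X ∈ Δ.flagSections i)
    (hY : Y ∈ Δ.flagSections j) : ⁅X, Y⁆ ∈ Δ.flagSections (i + j) := by
  induction i generalizing j X Y with
  | zero =>
    obtain rfl : X = 0 := by simpa [flagSections] using hX
    simp
  | succ i ih =>
    rcases i with _ | i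
    · rw [zero_add, add_comm]; exact Δ.lie_sections_mem hX hY
    · let ad : SmoothVF E M →ₗ[ℝ] SmoothVF E M := (LieModule.toEnd ℝ (SmoothVF E M) (SmoothVF E M) Y)
      have key : Δ.flagSections (i + 2) ≤ (Δ.flagSections (i + 2 + j)).comap ad := by
        refine sup_le (fun A hA => ?_) (Submodule.span_le.2 ?_)
        · change ⁅Y, A⁆ ∈ Δ.flagSections (i + 2 + j)
          rw [← lie_skew]
          exact Submodule.neg_mem _ (Δ.flagSections_mono (by omega) (ih hA hY))
        · rintro _ ⟨A, hA, B, hB, rfl⟩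
          change ⁅Y, ⁅A, B⁆⁆ ∈ Δ.flagSections (i + 2 + j)
          rw [← lie_skew, lie_lie]
          refine Submodule.neg_mem _ (Submodule.sub_mem _ ?_ ?_)
          · exact Δ.flagSections_mono (by omega) (Δ.lie_sections_mem hA (ih hB hY))
          · exact Δ.flagSections_mono (by omega) (ih hB (Δ.lie_sections_mem hA hY))
      have h := key hX
      change ⁅Y, X⁆ ∈ Δ.flagSections (i + 2 + j) at h
      rw [← lie_skew]
      exact Submodule.neg_mem _ h

/-! ### The Carnot algebra -/

/-- The submodule `Γ(Δ_{i-1}) + 𝔪_x Γ(Δ_i)` of `Γ(Δ_i)`, where `𝔪_x` is the ideal of smooth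
functions vanishing at `x`. -/
def fiberKer (x : M) (i : ℕ) : Submodule ℝ (SmoothVF E M) :=
  Δ.flagSections (i - 1) ⊔ Submodule.span ℝ
    {Z | ∃ f : C^∞⟮𝓘(ℝ, E), M; ℝ⟯, f x = 0 ∧ ∃ X ∈ Δ.flagSections i, Z = SmoothVF.fsmul f X}

theorem flagSections_le_fiberKer (x : M) {i j : ℕ} (h : i + 1 ≤ j) :
    Δ.flagSections i ≤ Δ.fiberKer x j :=
  le_trans (Δ.flagSections_mono (by omega)) le_sup_left

theorem lie_mem_fiberKer (x : M) {i j : ℕ} {X Y : SmoothVF E M} (hX : X ∈ Δ.flagSections i)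
    (hY : Y ∈ Δ.fiberKer x j) : ⁅X, Y⁆ ∈ Δ.fiberKer x (i + j) := by
  rcases i with _ | i
  · obtain rfl : X = 0 := by simpa [flagSections] using hX
    simp
  let ad : SmoothVF E M →ₗ[ℝ] SmoothVF E M := (LieModule.toEnd ℝ (SmoothVF E M) (SmoothVF E M) X)
  have key : Δ.fiberKer x j ≤ (Δ.fiberKer x (i + 1 + j)).comap ad := by
    refine sup_le (fun A hA => ?_) (Submodule.span_le.2 ?_)
    · change ⁅X, A⁆ ∈ Δ.fiberKer x (i + 1 + j)
      rcases j with _ | j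
      · obtain rfl : A = 0 := by simpa [flagSections] using hA
        simp
      · exact Δ.flagSections_le_fiberKer x (by omega) (Δ.lie_mem hX hA)
    · rintro _ ⟨f, hf, A, hA, rfl⟩
      change ⁅X, SmoothVF.fsmul f A⁆ ∈ Δ.fiberKer x (i + 1 + j)
      rw [SmoothVF.lie_fsmul]
      refine Submodule.add_mem _ ?_ ?_
      · exact Δ.flagSections_le_fiberKer x (by omega) (Δ.fsmul_mem j _ hA)
      · exact Submodule.mem_sup_right
          (Submodule.subset_span ⟨f, hf, _, Δ.lie_mem hX hA, rfl⟩)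
  exact key hY

/-- The component `g_{-i}(x)` of the Carnot algebra at `x`: the fibre at `x` of the quotient module
`Γ(Δ_i) / Γ(Δ_{i-1})`. (For a regular distribution, evaluation at `x` identifies it with
`Δ_i(x) / Δ_{i-1}(x)`.) -/
def CarnotPiece (x : M) (i : ℕ) : Type _ :=
  Δ.flagSections i ⧸ (Δ.fiberKer x i).submoduleOf (Δ.flagSections i)

instance (x : M) (i : ℕ) : AddCommGroup (Δ.CarnotPiece x i) :=
  inferInstanceAs (AddCommGroup
    (Δ.flagSections i ⧸ (Δ.fiberKer x i).submoduleOf (Δ.flagSections i)))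

instance (x : M) (i : ℕ) : Module ℝ (Δ.CarnotPiece x i) :=
  inferInstanceAs (Module ℝ
    (Δ.flagSections i ⧸ (Δ.fiberKer x i).submoduleOf (Δ.flagSections i)))

/-- The quotient map `Γ(Δ_i) → g_{-i}(x)`. -/
def pieceMk (x : M) (i : ℕ) : Δ.flagSections i →ₗ[ℝ] Δ.CarnotPiece x i :=
  Submodule.mkQ ((Δ.fiberKer x i).submoduleOf (Δ.flagSections i))

/-- The Carnot algebra `⨁ g_{-i}(x)` of `Δ` at `x`. -/
def Carnot (x : M) : Type _ := ⨁ i, Δ.CarnotPiece x i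

instance (x : M) : AddCommGroup (Δ.Carnot x) :=
  inferInstanceAs (AddCommGroup (⨁ i, Δ.CarnotPiece x i))

instance (x : M) : Module ℝ (Δ.Carnot x) :=
  inferInstanceAs (Module ℝ (⨁ i, Δ.CarnotPiece x i))

/-- The class in `g_{-i}(x)` of a field in `Γ(Δ_i)`. -/
def cls (x : M) (i : ℕ) : Δ.flagSections i →ₗ[ℝ] Δ.Carnot x :=
  DirectSum.lof ℝ ℕ (Δ.CarnotPiece x) i ∘ₗ Δ.pieceMk x i

theorem cls_eq_zero (x : M) {i : ℕ} {X : Δ.flagSections i} (h : X.1 ∈ Δ.fiberKer x i) :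
    Δ.cls x i X = 0 := by
  have h1 : Δ.pieceMk x i X = 0 :=
    (Submodule.Quotient.mk_eq_zero _).2 h
  change DirectSum.lof ℝ ℕ (Δ.CarnotPiece x) i (Δ.pieceMk x i X) = 0
  rw [h1, map_zero]

theorem cls_congr (x : M) {i j : ℕ} (h : i = j) {X : Δ.flagSections i} {Y : Δ.flagSections j}
    (hXY : X.1 = Y.1) : Δ.cls x i X = Δ.cls x j Y := by
  subst h
  rw [Subtype.ext hXY]

@[elab_as_elim]
theorem carnot_induction (x : M) {p : Δ.Carnot x → Prop} (zero : p 0)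
    (cls : ∀ i X, p (Δ.cls x i X)) (add : ∀ a b, p a → p b → p (a + b)) (a : Δ.Carnot x) : p a := by
  refine DirectSum.induction_on a zero (fun i q => ?_) add
  obtain ⟨X, rfl⟩ := Submodule.mkQ_surjective _ q
  exact cls i X

/-- The commutator `Γ(Δ_i) × Γ(Δ_j) → Γ(Δ_{i+j})`, followed by the class at `x`. -/
def preBracket (x : M) (i j : ℕ) : Δ.flagSections i →ₗ[ℝ] Δ.flagSections j →ₗ[ℝ] Δ.Carnot x :=
  LinearMap.mk₂ ℝ (fun X Y => Δ.cls x (i + j) ⟨⁅X.1, Y.1⁆, Δ.lie_mem X.2 Y.2⟩)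
    (fun X X' Y => by
      rw [← map_add]; exact Δ.cls_congr x rfl (add_lie X.1 X'.1 Y.1))
    (fun c X Y => by
      rw [← map_smul]; exact Δ.cls_congr x rfl (smul_lie c X.1 Y.1))
    (fun X Y Y' => by
      rw [← map_add]; exact Δ.cls_congr x rfl (lie_add X.1 Y.1 Y'.1))
    (fun c X Y => by
      rw [← map_smul]; exact Δ.cls_congr x rfl (lie_smul c X.1 Y.1))

/-- The bracket `g_{-i}(x) × g_{-j}(x) → g_{-i-j}(x)` induced by the commutator. -/
def pieceBracket (x : M) (i j : ℕ) :
    Δ.CarnotPiece x i →ₗ[ℝ] Δ.CarnotPiece x j →ₗ[ℝ] Δ.Carnot x :=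
  Submodule.liftQ _
    { toFun := fun X => Submodule.liftQ _ (Δ.preBracket x i j X) (fun Y hY => by
        exact Δ.cls_eq_zero x (Δ.lie_mem_fiberKer x X.2 hY))
      map_add' := fun X X' => by
        refine Submodule.linearMap_qext _ (LinearMap.ext fun Y => ?_)
        exact LinearMap.map_add₂ (Δ.preBracket x i j) X X' Y
      map_smul' := fun c X => by
        refine Submodule.linearMap_qext _ (LinearMap.ext fun Y => ?_)
        exact LinearMap.map_smul₂ (Δ.preBracket x i j) c X Y }
    (fun X hX => by
      refine Submodule.linearMap_qext _ (LinearMap.ext fun Y => ?_)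
      refine Δ.cls_eq_zero x ?_
      change ⁅X.1, Y.1⁆ ∈ Δ.fiberKer x (i + j)
      rw [← lie_skew, add_comm]
      exact Submodule.neg_mem _ (Δ.lie_mem_fiberKer x Y.2 hX))

/-- The bracket of the Carnot algebra as a bilinear map. -/
def carnotBracket (x : M) : Δ.Carnot x →ₗ[ℝ] Δ.Carnot x →ₗ[ℝ] Δ.Carnot x :=
  DirectSum.toModule ℝ ℕ _ fun i => LinearMap.flip
    (DirectSum.toModule ℝ ℕ _ fun j => (Δ.pieceBracket x i j).flip)

theorem carnotBracket_cls (x : M) (i j : ℕ) (X : Δ.flagSections i) (Y : Δ.flagSections j) :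
    Δ.carnotBracket x (Δ.cls x i X) (Δ.cls x j Y) =
      Δ.cls x (i + j) ⟨⁅X.1, Y.1⁆, Δ.lie_mem X.2 Y.2⟩ := by
  simp only [carnotBracket, cls, LinearMap.comp_apply]
  erw [DirectSum.toModule_lof, LinearMap.flip_apply, DirectSum.toModule_lof]
  rfl

instance (x : M) : Bracket (Δ.Carnot x) (Δ.Carnot x) where
  bracket a b := Δ.carnotBracket x a b

theorem lie_cls (x : M) (i j : ℕ) (X : Δ.flagSections i) (Y : Δ.flagSections j) :
    ⁅Δ.cls x i X, Δ.cls x j Y⁆ = Δ.cls x (i + j) ⟨⁅X.1, Y.1⁆, Δ.lie_mem X.2 Y.2⟩ :=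
  Δ.carnotBracket_cls x i j X Y

theorem carnotBracket_skew (x : M) (a b : Δ.Carnot x) :
    Δ.carnotBracket x a b = - Δ.carnotBracket x b a := by
  induction a using Δ.carnot_induction x with
  | zero => simp
  | add a a' h h' => simp only [map_add, LinearMap.add_apply, h, h', neg_add]
  | cls i X =>
    induction b using Δ.carnot_induction x with
    | zero => simp
    | add a a' h h' => simp only [map_add, LinearMap.add_apply, h, h', neg_add]
    | cls j Y =>
      rw [carnotBracket_cls, carnotBracket_cls, ← map_neg]
      exact Δ.cls_congr x (add_comm _ _) (lie_skew X.1 Y.1).symm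

instance (x : M) : LieRing (Δ.Carnot x) where
  add_lie a b c := LinearMap.map_add₂ (Δ.carnotBracket x) a b c
  lie_add a b c := map_add (Δ.carnotBracket x a) b c
  lie_self a := by
    have h : Δ.carnotBracket x a a = 0 := by
      have h := Δ.carnotBracket_skew x a a
      have h2 : (2 : ℝ) • Δ.carnotBracket x a a = 0 := by
        rw [two_smul]; exact add_eq_zero_iff_eq_neg.2 h
      exact (smul_eq_zero.1 h2).resolve_left two_ne_zero
    exact h
  leibniz_lie a b c := by
    change Δ.carnotBracket x a (Δ.carnotBracket x b c) =
      Δ.carnotBracket x (Δ.carnotBracket x a b) c + Δ.carnotBracket x b (Δ.carnotBracket x a c)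
    induction a using Δ.carnot_induction x with
    | zero => simp
    | add a a' h h' => simp only [map_add, LinearMap.add_apply, h, h']; abel
    | cls i X =>
    induction b using Δ.carnot_induction x with
    | zero => simp
    | add a a' h h' => simp only [map_add, LinearMap.add_apply, h, h']; abel
    | cls j Y =>
    induction c using Δ.carnot_induction x with
    | zero => simp
    | add a a' h h' => simp only [map_add, h, h']; abel
    | cls k Z =>
    simp only [carnotBracket_cls]
    have h1 : (⁅X.1, ⁅Y.1, Z.1⁆⁆ : SmoothVF E M) ∈ Δ.flagSections (i + (j + k)) :=
      Δ.lie_mem X.2 (Δ.lie_mem Y.2 Z.2)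
    have h2 : (⁅⁅X.1, Y.1⁆, Z.1⁆ : SmoothVF E M) ∈ Δ.flagSections (i + (j + k)) :=
      add_assoc i j k ▸ Δ.lie_mem (Δ.lie_mem X.2 Y.2) Z.2
    have h3 : (⁅Y.1, ⁅X.1, Z.1⁆⁆ : SmoothVF E M) ∈ Δ.flagSections (i + (j + k)) :=
      add_left_comm i j k ▸ Δ.lie_mem Y.2 (Δ.lie_mem X.2 Z.2)
    rw [Δ.cls_congr x (add_assoc i j k) (Y := ⟨_, h2⟩) rfl,
      Δ.cls_congr x (add_left_comm j i k) (Y := ⟨_, h3⟩) rfl, ← map_add]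
    exact Δ.cls_congr x rfl (leibniz_lie X.1 Y.1 Z.1)

instance (x : M) : LieAlgebra ℝ (Δ.Carnot x) where
  lie_smul c a b := map_smul (Δ.carnotBracket x a) c b

end TangentDistribution

end VectorFields

/-- A grading of a real Lie algebra by negative degrees; `piece i` is the component `g_{-i}`.
A finite-dimensional Lie algebra with such a grading (which is then nilpotent) is a
graded nilpotent Lie algebra (GNLA). -/
structure NegGrading (𝔪 : Type*) [LieRing 𝔪] [LieAlgebra ℝ 𝔪] where
  /-- the component of degree `-i` -/
  piece : ℕ → Submodule ℝ 𝔪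
  piece_zero : piece 0 = ⊥
  lie_mem : ∀ {i j : ℕ} {x y : 𝔪}, x ∈ piece i → y ∈ piece j → ⁅x, y⁆ ∈ piece (i + j)
  isInternal : DirectSum.IsInternal piece

namespace NegGrading

variable {𝔪 : Type*} [LieRing 𝔪] [LieAlgebra ℝ 𝔪] (G : NegGrading 𝔪)

/-- The grading is fundamental: `g_{-1}` generates the Lie algebra. -/
def IsFundamental : Prop := LieSubalgebra.lieSpan ℝ 𝔪 (G.piece 1) = ⊤

/-- The projection of `𝔪` onto `g_{-i}`. -/
def proj (i : ℕ) : 𝔪 →ₗ[ℝ] 𝔪 :=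
  (G.piece i).subtype ∘ₗ DirectSum.component ℝ ℕ (fun i => G.piece i) i ∘ₗ
    (LinearEquiv.ofBijective (DirectSum.coeLinearMap G.piece) G.isInternal).symm.toLinearMap

theorem proj_mem (i : ℕ) (v : 𝔪) : G.proj i v ∈ G.piece i := Subtype.property _

theorem proj_of_mem {i : ℕ} {v : 𝔪} (h : v ∈ G.piece i) : G.proj i v = v :=
  congrArg Subtype.val (G.isInternal.ofBijective_coeLinearMap_of_mem h)

theorem proj_of_mem_ne {i j : ℕ} (hij : i ≠ j) {v : 𝔪} (h : v ∈ G.piece i) : G.proj j v = 0 :=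
  congrArg Subtype.val (G.isInternal.ofBijective_coeLinearMap_of_mem_ne hij h)

theorem piece_induction {p : 𝔪 → Prop} (zero : p 0) (add : ∀ a b, p a → p b → p (a + b))
    (mem : ∀ i, ∀ v ∈ G.piece i, p v) (v : 𝔪) : p v := by
  have h : v ∈ ⨆ i, G.piece i := by rw [G.isInternal.submodule_iSup_eq_top]; trivial
  exact Submodule.iSup_induction G.piece (motive := p) h mem zero add

theorem eq_zero_of_proj {v : 𝔪} (h : ∀ i, G.proj i v = 0) : v = 0 := by
  have h1 : (LinearEquiv.ofBijective (DirectSum.coeLinearMap G.piece) G.isInternal).symm v = 0 := by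
    ext i; exact h i
  simpa using h1

/-- The filtration `⨁_{i ≥ n} g_{-i}`. -/
def fil (n : ℕ) : Submodule ℝ 𝔪 := ⨅ i, ⨅ _ : i < n, LinearMap.ker (G.proj i)

theorem mem_fil {n : ℕ} {v : 𝔪} : v ∈ G.fil n ↔ ∀ i < n, G.proj i v = 0 := by
  simp [fil]

theorem piece_le_fil {i n : ℕ} (h : n ≤ i) : G.piece i ≤ G.fil n := fun _ hv =>
  G.mem_fil.2 fun _ hj => G.proj_of_mem_ne (by omega) hv

theorem fil_anti {i n : ℕ} (h : n ≤ i) : G.fil i ≤ G.fil n := fun _ hv =>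
  G.mem_fil.2 fun j hj => G.mem_fil.1 hv j (by omega)

theorem proj_zero_apply (v : 𝔪) : G.proj 0 v = 0 := by
  have h := G.proj_mem 0 v
  rwa [G.piece_zero, Submodule.mem_bot] at h

theorem mem_fil_one (v : 𝔪) : v ∈ G.fil 1 := G.mem_fil.2 fun i hi => by
  obtain rfl : i = 0 := by omega
  exact G.proj_zero_apply v

variable [FiniteDimensional ℝ 𝔪]

theorem exists_depth : ∃ N : ℕ, ∀ n, N ≤ n → G.piece n = ⊥ := by
  have h := WellFoundedGT.finite_ne_bot_of_iSupIndep G.isInternal.submodule_iSupIndep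
  obtain ⟨N, hN⟩ := h.bddAbove
  refine ⟨N + 1, fun n hn => ?_⟩
  by_contra hne
  have := hN hne
  omega

/-- A bound on the degrees: `g_{-n} = 0` for `n ≥ depth`. -/
def depth : ℕ := G.exists_depth.choose

theorem piece_eq_bot {n : ℕ} (h : G.depth ≤ n) : G.piece n = ⊥ := G.exists_depth.choose_spec n h

theorem sum_proj (v : 𝔪) : ∑ i ∈ Finset.range G.depth, G.proj i v = v := by
  refine G.piece_induction (p := fun v => ∑ i ∈ Finset.range G.depth, G.proj i v = v)
    (by simp) (fun a b ha hb => ?_) (fun j v hv => ?_) v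
  · simp only [map_add, Finset.sum_add_distrib, ha, hb]
  · by_cases hj : G.depth ≤ j
    · rw [G.piece_eq_bot hj, Submodule.mem_bot] at hv
      simp [hv]
    · rw [Finset.sum_eq_single j (fun i _ hij => G.proj_of_mem_ne (Ne.symm hij) hv)
        (fun h => absurd (Finset.mem_range.2 (by omega)) h), G.proj_of_mem hv]

theorem lie_mem_fil {a b : ℕ} {v w : 𝔪} (hv : v ∈ G.fil a) (hw : w ∈ G.fil b) :
    ⁅v, w⁆ ∈ G.fil (a + b) := by
  rw [← G.sum_proj v, ← G.sum_proj w, lie_sum]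
  refine Submodule.sum_mem _ fun j _ => ?_
  rw [sum_lie]
  refine Submodule.sum_mem _ fun i _ => ?_
  by_cases hi : i < a
  · simp [G.mem_fil.1 hv i hi]
  by_cases hj : j < b
  · simp [G.mem_fil.1 hw j hj]
  exact G.piece_le_fil (by omega) (G.lie_mem (G.proj_mem i v) (G.proj_mem j w))

/-- The grading derivation, equal to `i` on `g_{-i}`. -/
def degree : 𝔪 →ₗ[ℝ] 𝔪 := ∑ i ∈ Finset.range G.depth, (i : ℝ) • G.proj i

theorem degree_of_mem {i : ℕ} {v : 𝔪} (hv : v ∈ G.piece i) : G.degree v = (i : ℝ) • v := by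
  by_cases hj : G.depth ≤ i
  · rw [G.piece_eq_bot hj, Submodule.mem_bot] at hv
    simp [hv]
  · simp only [degree, LinearMap.sum_apply, LinearMap.smul_apply]
    rw [Finset.sum_eq_single i (fun j _ hij => by rw [G.proj_of_mem_ne (Ne.symm hij) hv, smul_zero])
        (fun h => absurd (Finset.mem_range.2 (by omega)) h), G.proj_of_mem hv]

theorem degree_lie (v w : 𝔪) : G.degree ⁅v, w⁆ = ⁅G.degree v, w⁆ + ⁅v, G.degree w⁆ := by
  induction v using G.piece_induction with
  | zero => simp
  | add a b ha hb => simp only [add_lie, map_add, ha, hb]; abel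
  | mem i v hv =>
  induction w using G.piece_induction with
  | zero => simp
  | add a b ha hb => simp only [lie_add, map_add, ha, hb]; abel
  | mem j w hw =>
  rw [G.degree_of_mem hv, G.degree_of_mem hw, G.degree_of_mem (G.lie_mem hv hw), smul_lie,
    lie_smul, ← add_smul, Nat.cast_add]

theorem proj_degree (i : ℕ) (v : 𝔪) : G.proj i (G.degree v) = (i : ℝ) • G.proj i v := by
  induction v using G.piece_induction with
  | zero => simp
  | add a b ha hb => simp only [map_add, ha, hb, smul_add]
  | mem j v hv =>
    rw [G.degree_of_mem hv, map_smul]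
    by_cases h : j = i
    · rw [h]
    · rw [G.proj_of_mem_ne h hv, smul_zero, smul_zero]

theorem eq_zero_of_fil {v : 𝔪} (n : ℕ) (h : ∀ j, n ≤ j → v ∈ G.fil j) : v = 0 :=
  G.eq_zero_of_proj fun i => G.mem_fil.1 (h (max n (i + 1)) (le_max_left _ _)) i (by omega)

/-- An eigenvector of `degree - ad u` of eigenvalue `n` without components in degrees `≤ n`
vanishes. -/
theorem eq_zero_of_eigen (u : 𝔪) {w : 𝔪} {n : ℕ} (h : G.degree w - ⁅u, w⁆ = (n : ℝ) • w)
    (hw : w ∈ G.fil (n + 1)) : w = 0 := by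
  refine G.eq_zero_of_fil (n + 1) fun j hj => ?_
  induction j, hj using Nat.le_induction with
  | base => exact hw
  | succ j hj ih =>
    refine G.mem_fil.2 fun i hi => ?_
    rcases Nat.lt_succ_iff_lt_or_eq.1 hi with hi | rfl
    · exact G.mem_fil.1 ih i hi
    · have h1 : G.proj i ⁅u, w⁆ = 0 := G.mem_fil.1 (G.lie_mem_fil (G.mem_fil_one u) ih) i (by omega)
      have h2 := congrArg (G.proj i) h
      rw [map_sub, h1, sub_zero, G.proj_degree, map_smul] at h2
      have h3 : ((i : ℝ) - n) • G.proj i w = 0 := by rw [sub_smul, h2, sub_self]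
      refine (smul_eq_zero.1 h3).resolve_left ?_
      have : (n : ℝ) < i := by exact_mod_cast hj
      linarith

/-- The components of `frame u`: `frameAux u s` maps `g_{-i}` to `g_{-i-s}`. -/
def frameAux (u : 𝔪) : ℕ → (𝔪 →ₗ[ℝ] 𝔪)
  | 0 => LinearMap.id
  | s + 1 => ((s : ℝ) + 1)⁻¹ • ∑ l : Fin (s + 1),
      (LieAlgebra.ad ℝ 𝔪 (G.proj (l + 1) u)) ∘ₗ frameAux u (s - l)
  decreasing_by omega

theorem frameAux_succ (u : 𝔪) (s : ℕ) : G.frameAux u (s + 1) = ((s : ℝ) + 1)⁻¹ •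
    ∑ l : Fin (s + 1), (LieAlgebra.ad ℝ 𝔪 (G.proj (l + 1) u)) ∘ₗ G.frameAux u (s - l) := by
  rw [frameAux]

theorem frameAux_mem (u : 𝔪) (s : ℕ) {i : ℕ} {v : 𝔪} (hv : v ∈ G.piece i) :
    G.frameAux u s v ∈ G.piece (i + s) := by
  induction s using Nat.strong_induction_on with
  | _ s ih =>
  rcases s with _ | s
  · rw [frameAux]; exact hv
  · rw [frameAux_succ, LinearMap.smul_apply, LinearMap.sum_apply]
    refine Submodule.smul_mem _ _ (Submodule.sum_mem _ fun l _ => ?_)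
    have h := G.lie_mem (G.proj_mem (l + 1) u) (ih (s - l) (by omega))
    have e : (l : ℕ) + 1 + (i + (s - l)) = i + (s + 1) := by omega
    rw [e] at h
    exact h

theorem frameAux_eq_zero (u : 𝔪) {s : ℕ} (hs : G.depth ≤ s) : G.frameAux u s = 0 := by
  ext v
  induction v using G.piece_induction with
  | zero => simp
  | add a b ha hb => rw [map_add, ha, hb, map_add]
  | mem i v hv =>
    have h := G.frameAux_mem u s hv
    rwa [G.piece_eq_bot (by omega), Submodule.mem_bot] at h

theorem smul_frameAux (u : 𝔪) (n : ℕ) (v : 𝔪) : (n : ℝ) • G.frameAux u n v =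
    ∑ q ∈ Finset.HasAntidiagonal.antidiagonal n, ⁅G.proj q.1 u, G.frameAux u q.2 v⁆ := by
  rcases n with _ | s
  · simp [proj_zero_apply]
  · rw [frameAux_succ, Finset.Nat.antidiagonal_succ, Finset.sum_cons, Finset.sum_map]
    simp only [proj_zero_apply, zero_lie, zero_add]
    rw [Finset.Nat.sum_antidiagonal_eq_sum_range_succ_mk, LinearMap.smul_apply, smul_smul,
      Nat.cast_succ, mul_inv_cancel₀ (by positivity), one_smul, LinearMap.sum_apply]
    exact Fin.sum_univ_eq_sum_range (fun l => ⁅G.proj (l + 1) u, G.frameAux u (s - l) v⁆) (s + 1)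

/-- The unipotent automorphism `A_u` of `𝔪` that conjugates the grading derivation to
`degree - ad u`. -/
def frame (u : 𝔪) : 𝔪 →ₗ[ℝ] 𝔪 := ∑ s ∈ Finset.range G.depth, G.frameAux u s

theorem frame_apply (u v : 𝔪) {N : ℕ} (hN : G.depth ≤ N) :
    G.frame u v = ∑ s ∈ Finset.range N, G.frameAux u s v := by
  rw [frame, LinearMap.sum_apply]
  refine Finset.sum_subset (Finset.range_mono hN) fun s _ hs => ?_
  rw [G.frameAux_eq_zero u (by simpa using hs)]; rfl

theorem frame_comm (u v : 𝔪) :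
    G.degree (G.frame u v) - ⁅u, G.frame u v⁆ = G.frame u (G.degree v) := by
  induction v using G.piece_induction with
  | zero => simp
  | add a b ha hb => simp only [map_add, lie_add, ← ha, ← hb]; abel
  | mem i v hv =>
  set N := G.depth with hN
  have h1 : ⁅u, G.frame u v⁆ = ∑ n ∈ Finset.range N, (n : ℝ) • G.frameAux u n v := by
    have h2 : ⁅u, G.frame u v⁆ = ∑ q ∈ Finset.range N ×ˢ Finset.range N,
        ⁅G.proj q.1 u, G.frameAux u q.2 v⁆ := by
      rw [Finset.sum_product]
      conv_lhs => rw [← G.sum_proj u, sum_lie]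
      refine Finset.sum_congr rfl fun l _ => ?_
      rw [G.frame_apply (N := N) _ _ le_rfl, G.sum_proj, lie_sum]
    rw [h2]
    have h3 : ∑ q ∈ Finset.range N ×ˢ Finset.range N, ⁅G.proj q.1 u, G.frameAux u q.2 v⁆ =
        ∑ q ∈ (Finset.range N ×ˢ Finset.range N).filter (fun q => q.1 + q.2 < N),
          ⁅G.proj q.1 u, G.frameAux u q.2 v⁆ := by
      symm
      refine Finset.sum_subset (Finset.filter_subset _ _) fun q hq hq' => ?_
      have h4 := G.lie_mem (G.proj_mem q.1 u) (G.frameAux_mem u q.2 hv)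
      have h5 : N ≤ q.1 + q.2 := by
        by_contra hlt
        exact hq' (Finset.mem_filter.2 ⟨hq, by omega⟩)
      rwa [G.piece_eq_bot (by omega), Submodule.mem_bot] at h4
    rw [h3, ← Finset.sum_fiberwise_of_maps_to (t := Finset.range N) (g := fun q : ℕ × ℕ => q.1 + q.2)
      (fun q hq => Finset.mem_range.2 (Finset.mem_filter.1 hq).2)]
    refine Finset.sum_congr rfl fun n hn => ?_
    rw [smul_frameAux]
    refine Finset.sum_congr ?_ fun _ _ => rfl
    ext ⟨a, b⟩
    simp only [Finset.mem_filter, Finset.mem_product, Finset.mem_range,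
      Finset.HasAntidiagonal.mem_antidiagonal] at hn ⊢
    omega
  rw [h1, G.frame_apply u v (N := N) le_rfl, G.degree_of_mem hv, map_smul,
    G.frame_apply u v (N := N) le_rfl, map_sum, Finset.smul_sum, ← Finset.sum_sub_distrib]
  refine Finset.sum_congr rfl fun s _ => ?_
  rw [G.degree_of_mem (G.frameAux_mem u s hv), Nat.cast_add, add_smul, add_sub_cancel_right]

theorem frame_sub_mem (u : 𝔪) {n : ℕ} {v : 𝔪} (hv : v ∈ G.fil n) :
    G.frame u v - v ∈ G.fil (n + 1) := by
  have key : ∀ i, ∀ w ∈ G.piece i, G.frame u w - w ∈ G.fil (i + 1) := by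
    intro i w hw
    rw [G.frame_apply u w (Nat.le_succ _), Finset.sum_range_succ']
    have : G.frameAux u 0 w = w := by rw [frameAux]; rfl
    rw [this, add_sub_cancel_right]
    refine Submodule.sum_mem _ fun s _ => ?_
    exact G.piece_le_fil (by omega) (G.frameAux_mem u (s + 1) hw)
  have h : G.frame u v - v = ∑ i ∈ Finset.range G.depth,
      (G.frame u (G.proj i v) - G.proj i v) := by
    rw [Finset.sum_sub_distrib, ← map_sum, G.sum_proj]
  rw [h]
  refine Submodule.sum_mem _ fun i _ => ?_
  by_cases hi : i < n
  · simp [G.mem_fil.1 hv i hi]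
  · exact G.fil_anti (by omega) (key i _ (G.proj_mem i v))

theorem frame_mem_fil (u : 𝔪) {n : ℕ} {v : 𝔪} (hv : v ∈ G.fil n) : G.frame u v ∈ G.fil n := by
  have h := Submodule.add_mem _ (G.fil_anti (Nat.le_succ n) (G.frame_sub_mem u hv)) hv
  rwa [sub_add_cancel] at h

theorem frame_zero : G.frame 0 = LinearMap.id := by
  ext v
  induction v using G.piece_induction with
  | zero => simp
  | add a b ha hb => simp only [map_add, ha, hb]
  | mem i v hv =>
    refine sub_eq_zero.1 (G.eq_zero_of_eigen 0 (n := i) ?_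
      (G.frame_sub_mem 0 (G.piece_le_fil le_rfl hv)))
    have h := G.frame_comm 0 v
    rw [zero_lie, sub_zero, G.degree_of_mem hv, map_smul] at h
    simp only [LinearMap.id_apply, zero_lie, sub_zero, map_sub, h, G.degree_of_mem hv, smul_sub]

theorem frame_lie (u v w : 𝔪) : G.frame u ⁅v, w⁆ = ⁅G.frame u v, G.frame u w⁆ := by
  induction v using G.piece_induction with
  | zero => simp
  | add a b ha hb => simp only [add_lie, map_add, ha, hb]
  | mem i v hv =>
  induction w using G.piece_induction with
  | zero => simp
  | add a b ha hb => simp only [lie_add, map_add, ha, hb]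
  | mem j w hw =>
  refine sub_eq_zero.1 (G.eq_zero_of_eigen u (n := i + j) ?_ ?_)
  · have hv' := G.frame_comm u v
    have hw' := G.frame_comm u w
    have hvw := G.frame_comm u ⁅v, w⁆
    rw [G.degree_of_mem hv, map_smul, sub_eq_iff_eq_add] at hv'
    rw [G.degree_of_mem hw, map_smul, sub_eq_iff_eq_add] at hw'
    rw [G.degree_of_mem (G.lie_mem hv hw), map_smul, sub_eq_iff_eq_add] at hvw
    rw [map_sub, hvw, G.degree_lie, hv', hw', lie_sub, smul_sub]
    simp only [add_lie, lie_add, smul_lie, lie_smul, lie_lie u, Nat.cast_add, add_smul]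
    rw [leibniz_lie u (G.frame u v)]
    abel
  · have e : G.frame u ⁅v, w⁆ - ⁅G.frame u v, G.frame u w⁆ = (G.frame u ⁅v, w⁆ - ⁅v, w⁆) -
        (⁅G.frame u v - v, G.frame u w⁆ + ⁅v, G.frame u w - w⁆) := by
      simp only [sub_lie, lie_sub]; abel
    have hv' := G.piece_le_fil le_rfl hv
    have hw' := G.piece_le_fil le_rfl hw
    rw [e]
    refine Submodule.sub_mem _ (G.frame_sub_mem u (G.piece_le_fil le_rfl (G.lie_mem hv hw)))
      (Submodule.add_mem _ ?_ ?_)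
    · exact G.fil_anti (by omega) (G.lie_mem_fil (G.frame_sub_mem u hv') (G.frame_mem_fil u hw'))
    · exact G.fil_anti (by omega) (G.lie_mem_fil hv' (G.frame_sub_mem u hw'))

theorem frame_add_frame (u v w : 𝔪) :
    G.frame (u + G.frame u v) w = G.frame u (G.frame v w) := by
  induction w using G.piece_induction with
  | zero => simp
  | add a b ha hb => simp only [map_add, ha, hb]
  | mem i w hw =>
  refine sub_eq_zero.1 (G.eq_zero_of_eigen (u + G.frame u v) (n := i) ?_ ?_)
  · have h1 := G.frame_comm (u + G.frame u v) w
    have h2 := G.frame_comm v w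
    have h3 := G.frame_comm u (G.frame v w)
    rw [G.degree_of_mem hw, map_smul] at h1 h2
    rw [sub_eq_iff_eq_add.1 h2, map_add, map_smul, G.frame_lie] at h3
    rw [map_sub, lie_sub, sub_sub_sub_comm, h1, add_lie, sub_add_eq_sub_sub, h3, smul_sub]
    abel
  · have hw' := G.piece_le_fil le_rfl hw
    have e : G.frame (u + G.frame u v) w - G.frame u (G.frame v w) =
        (G.frame (u + G.frame u v) w - w) - (G.frame u (G.frame v w) - G.frame v w)
          - (G.frame v w - w) := by abel
    rw [e]
    exact Submodule.sub_mem _ (Submodule.sub_mem _ (G.frame_sub_mem _ hw')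
      (G.frame_sub_mem _ (G.frame_mem_fil _ hw'))) (G.frame_sub_mem _ hw')

theorem frame_injective (u : 𝔪) : Function.Injective (G.frame u) := by
  refine (injective_iff_map_eq_zero _).2 fun v hv => ?_
  refine G.eq_zero_of_fil 0 fun j hj => ?_
  clear hj
  induction j with
  | zero => exact G.mem_fil.2 fun i hi => absurd hi (by omega)
  | succ j ih =>
    have h := G.frame_sub_mem u ih
    rw [hv, zero_sub] at h
    exact (Submodule.neg_mem_iff _).1 h

/-- `A_u` as a linear automorphism. -/
def frameEquiv (u : 𝔪) : 𝔪 ≃ₗ[ℝ] 𝔪 := LinearEquiv.ofInjectiveEndo (G.frame u) (G.frame_injective u)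

theorem degree_injective : Function.Injective G.degree := by
  refine (injective_iff_map_eq_zero _).2 fun v hv => G.eq_zero_of_proj fun i => ?_
  have h := G.proj_degree i v
  rw [hv, map_zero] at h
  rcases i with _ | i
  · exact G.proj_zero_apply v
  · exact (smul_eq_zero.1 h.symm).resolve_left (by positivity)

end NegGrading

namespace NegGrading

variable {𝔪 : Type*} [LieRing 𝔪] [LieAlgebra ℝ 𝔪] [FiniteDimensional ℝ 𝔪] (G : NegGrading 𝔪)

/-- The vector space `𝔪` with an (auxiliary) norm. -/
@[nolint unusedArguments]
def Space (_ : NegGrading 𝔪) : Type _ := 𝔪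

instance : AddCommGroup G.Space := inferInstanceAs (AddCommGroup 𝔪)
instance : Module ℝ G.Space := inferInstanceAs (Module ℝ 𝔪)
instance : FiniteDimensional ℝ G.Space := inferInstanceAs (FiniteDimensional ℝ 𝔪)

/-- Coordinates on `𝔪`. -/
def coord : G.Space ≃ₗ[ℝ] (Fin (Module.finrank ℝ 𝔪) → ℝ) := (Module.finBasis ℝ 𝔪).equivFun

instance : NormedAddCommGroup G.Space :=
  NormedAddCommGroup.induced G.Space (Fin (Module.finrank ℝ 𝔪) → ℝ) G.coord.toLinearMap
    G.coord.injective

instance : NormedSpace ℝ G.Space :=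
  NormedSpace.induced ℝ G.Space (Fin (Module.finrank ℝ 𝔪) → ℝ) G.coord.toLinearMap

instance : CompleteSpace G.Space := FiniteDimensional.complete ℝ G.Space

/-- The identity map `𝔪 → G.Space`. -/
def toSpace : 𝔪 ≃ₗ[ℝ] G.Space := LinearEquiv.refl ℝ 𝔪

/-- An endomorphism of `𝔪` as a continuous linear map. -/
def clm : (𝔪 →ₗ[ℝ] 𝔪) →ₗ[ℝ] (G.Space →L[ℝ] G.Space) :=
  (LinearMap.toContinuousLinearMap (𝕜 := ℝ) (E := G.Space) (F' := G.Space)).toLinearMap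

/-- The bracket of `𝔪` as a continuous bilinear map. -/
def adL : G.Space →L[ℝ] G.Space →L[ℝ] G.Space :=
  LinearMap.toContinuousLinearMap
    (G.clm ∘ₗ (LieModule.toEnd ℝ 𝔪 𝔪 : 𝔪 →ₗ[ℝ] Module.End ℝ 𝔪) : G.Space →ₗ[ℝ] _)

theorem clm_frameAux_zero (u : 𝔪) : G.clm (G.frameAux u 0) = ContinuousLinearMap.id ℝ _ := by
  rw [frameAux]; rfl

theorem clm_frameAux_succ (u : 𝔪) (s : ℕ) : G.clm (G.frameAux u (s + 1)) = ((s : ℝ) + 1)⁻¹ •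
    ∑ l : Fin (s + 1), ((G.adL.comp (G.clm (G.proj (l + 1)))) (G.toSpace u)).comp
      (G.clm (G.frameAux u (s - l))) := by
  rw [frameAux_succ, map_smul, map_sum]
  rfl

theorem contDiff_frameAux (n : WithTop ℕ∞) (s : ℕ) :
    ContDiff ℝ n (fun u : G.Space => G.clm (G.frameAux u s)) := by
  induction s using Nat.strong_induction_on with
  | _ s ih =>
  rcases s with _ | s
  · have : (fun u : G.Space => G.clm (G.frameAux u 0)) =
        fun _ => ContinuousLinearMap.id ℝ _ := funext fun u => G.clm_frameAux_zero u
    rw [this]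
    exact contDiff_const
  · have h := funext fun u : G.Space => G.clm_frameAux_succ u s
    refine h ▸ ContDiff.const_smul _ (ContDiff.sum fun l _ => ?_)
    exact (ContinuousLinearMap.contDiff _).clm_comp (ih _ (by omega))

/-- `A_u` as a continuous linear map. -/
def frameL (u : G.Space) : G.Space →L[ℝ] G.Space := G.clm (G.frame u)

theorem contDiff_frameL (n : WithTop ℕ∞) : ContDiff ℝ n G.frameL := by
  have h : G.frameL = fun u => ∑ s ∈ Finset.range G.depth, G.clm (G.frameAux u s) := by
    funext u; exact map_sum G.clm _ _
  rw [h]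
  exact ContDiff.sum fun s _ => G.contDiff_frameAux n s

/-- The product of the group `G.FlatModel`. -/
def mulFun (u v : 𝔪) : 𝔪 := u + G.frame u v

/-- The inversion of the group `G.FlatModel`. -/
def invFun (u : 𝔪) : 𝔪 := -(G.frameEquiv u).symm u

theorem mulFun_assoc (u v w : 𝔪) :
    G.mulFun (G.mulFun u v) w = G.mulFun u (G.mulFun v w) := by
  simp only [mulFun, frame_add_frame, map_add, add_assoc]

theorem mulFun_zero (u : 𝔪) : G.mulFun u 0 = u := by simp [mulFun]

theorem mulFun_invFun (u : 𝔪) : G.mulFun u (G.invFun u) = 0 := by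
  have h : G.frame u ((G.frameEquiv u).symm u) = u := (G.frameEquiv u).apply_symm_apply u
  simp [mulFun, invFun, h]

/-- The simply connected nilpotent Lie group with Lie algebra `𝔪`, realized on the vector space
`𝔪`: the product is `u * v = u + A_u v`. -/
def FlatModel : Type _ := G.Space

instance : TopologicalSpace G.FlatModel := inferInstanceAs (TopologicalSpace G.Space)
instance : ChartedSpace G.Space G.FlatModel := inferInstanceAs (ChartedSpace G.Space G.Space)
instance (n : WithTop ℕ∞) : IsManifold 𝓘(ℝ, G.Space) n G.FlatModel :=
  inferInstanceAs (IsManifold 𝓘(ℝ, G.Space) n G.Space)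

/-- The identity map `G.Space → G.FlatModel`. -/
def toModel : G.Space ≃ G.FlatModel := Equiv.refl _

instance : Mul G.FlatModel := ⟨G.mulFun⟩
instance : One G.FlatModel := ⟨(0 : 𝔪)⟩
instance : Inv G.FlatModel := ⟨G.invFun⟩

instance : Group G.FlatModel :=
  Group.ofRightAxioms G.mulFun_assoc G.mulFun_zero G.mulFun_invFun

theorem contDiff_mul (n : WithTop ℕ∞) :
    ContDiff ℝ n (fun p : G.Space × G.Space => p.1 + G.frameL p.1 p.2) :=
  contDiff_fst.add (((G.contDiff_frameL n).comp contDiff_fst).clm_apply contDiff_snd)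

theorem contDiff_inv (n : WithTop ℕ∞) :
    ContDiff ℝ n (fun u : G.Space => -((G.frameL u).inverse u)) := by
  refine ContDiff.neg (ContDiff.clm_apply ?_ contDiff_id)
  refine contDiff_iff_contDiffAt.2 fun u => ?_
  let e : G.Space ≃L[ℝ] G.Space :=
    LinearEquiv.toContinuousLinearEquiv (E := G.Space) (F := G.Space) (G.frameEquiv u)
  have h : ((e : G.Space ≃L[ℝ] G.Space) : G.Space →L[ℝ] G.Space) = G.frameL u := by
    ext v; rfl
  exact ContDiffAt.comp u (h ▸ contDiffAt_map_inverse e) (G.contDiff_frameL n).contDiffAt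

theorem frameL_inverse (u : G.Space) :
    (G.frameL u).inverse u = (G.frameEquiv u).symm u := by
  let e : G.Space ≃L[ℝ] G.Space :=
    LinearEquiv.toContinuousLinearEquiv (E := G.Space) (F := G.Space) (G.frameEquiv u)
  have h : G.frameL u = ((e : G.Space ≃L[ℝ] G.Space) : G.Space →L[ℝ] G.Space) := by
    ext v; rfl
  rw [h, ContinuousLinearMap.inverse_equiv]
  rfl

instance (n : WithTop ℕ∞) : LieGroup 𝓘(ℝ, G.Space) n G.FlatModel where
  contMDiff_mul := by
    have h := (G.contDiff_mul n).contMDiff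
    rw [modelWithCornersSelf_prod, ← chartedSpaceSelf_prod] at h
    exact h
  contMDiff_inv := by
    have h := (G.contDiff_inv n).contMDiff
    simp only [frameL_inverse] at h
    exact h

/-- Left invariant fields are `u ↦ A_u v`. -/
theorem mulInvariantVectorField_eq (v : G.Space) (u : G.FlatModel) :
    mulInvariantVectorField (I := 𝓘(ℝ, G.Space)) (G := G.FlatModel) v u = G.frameL (G.toModel.symm u) v := by
  have h : HasFDerivAt (fun w : G.Space => G.toModel.symm u + G.frameL (G.toModel.symm u) w)
      (G.frameL (G.toModel.symm u)) 0 :=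
    (G.frameL _).hasFDerivAt.const_add _
  exact congrArg (fun L : G.Space →L[ℝ] G.Space => L v) (h.hasMFDerivAt.mfderiv)

theorem frameAux_zero_left (s : ℕ) : G.frameAux 0 (s + 1) = 0 := by
  rw [frameAux_succ]
  simp

theorem hasFDerivAt_frameAux (s : ℕ) :
    HasFDerivAt (fun u : G.Space => G.clm (G.frameAux u (s + 1)))
      (((s : ℝ) + 1)⁻¹ • G.adL.comp (G.clm (G.proj (s + 1)))) 0 := by
  have h := funext fun u : G.Space => G.clm_frameAux_succ u s
  have hd : ∀ k, DifferentiableAt ℝ (fun u : G.Space => G.clm (G.frameAux u k)) 0 := fun k =>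
    ((G.contDiff_frameAux 1 k).differentiable one_ne_zero).differentiableAt
  have h1 := HasFDerivAt.const_smul (HasFDerivAt.fun_sum (u := Finset.univ)
    fun (l : Fin (s + 1)) _ =>
      ((G.adL.comp (G.clm (G.proj (l + 1)))).hasFDerivAt (x := 0)).clm_comp
        (hd (s - l)).hasFDerivAt) ((s : ℝ) + 1)⁻¹
  rw [h]
  refine h1.congr_fderiv ?_
  congr 1
  have h0 : ∀ l : Fin (s + 1), l ≠ Fin.last s → G.clm (G.frameAux (0 : G.Space) (s - l)) = 0 := by
    intro l hl
    have hlt : (l : ℕ) < s := Fin.val_lt_last hl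
    obtain ⟨k, hk⟩ : ∃ k, s - (l : ℕ) = k + 1 := ⟨s - l - 1, by omega⟩
    rw [hk]
    exact (congrArg G.clm (G.frameAux_zero_left k)).trans (map_zero G.clm)
  rw [Finset.sum_eq_single (Fin.last s)]
  · have hl : G.clm (G.frameAux (0 : G.Space) (s - (Fin.last s : ℕ))) = ContinuousLinearMap.id ℝ _ := by
      rw [Fin.val_last, Nat.sub_self]
      exact G.clm_frameAux_zero 0
    ext x y
    have := congrArg (fun L => (G.adL (G.clm (G.proj (s + 1)) x)) (L y)) hl
    simpa using this
  · intro l _ hl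
    ext x y
    have := congrArg (fun L => (G.adL (G.clm (G.proj (l + 1)) x)) (L y)) (h0 l hl)
    simpa using this
  · exact fun h => absurd (Finset.mem_univ _) h

/-- The inverse of the grading derivation. -/
def degreeInv : 𝔪 →ₗ[ℝ] 𝔪 := ∑ i ∈ Finset.range G.depth, (i : ℝ)⁻¹ • G.proj i

theorem degreeInv_of_mem {i : ℕ} {v : 𝔪} (hv : v ∈ G.piece i) :
    G.degreeInv v = (i : ℝ)⁻¹ • v := by
  by_cases hj : G.depth ≤ i
  · rw [G.piece_eq_bot hj, Submodule.mem_bot] at hv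
    simp [hv]
  · simp only [degreeInv, LinearMap.sum_apply, LinearMap.smul_apply]
    rw [Finset.sum_eq_single i (fun j _ hij => by rw [G.proj_of_mem_ne (Ne.symm hij) hv, smul_zero])
        (fun h => absurd (Finset.mem_range.2 (by omega)) h), G.proj_of_mem hv]

theorem degreeInv_degree (v : 𝔪) : G.degreeInv (G.degree v) = v := by
  induction v using G.piece_induction with
  | zero => simp
  | add a b ha hb => simp only [map_add, ha, hb]
  | mem i v hv =>
    rw [G.degree_of_mem hv, map_smul, G.degreeInv_of_mem hv, smul_smul]
    rcases i with _ | i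
    · rw [G.piece_zero, Submodule.mem_bot] at hv
      simp [hv]
    · rw [mul_inv_cancel₀ (by positivity), one_smul]

/-- The grading derivation as a linear automorphism. -/
def degreeEquiv : 𝔪 ≃ₗ[ℝ] 𝔪 := LinearEquiv.ofInjectiveEndo G.degree G.degree_injective

theorem hasFDerivAt_frameL : HasFDerivAt G.frameL (G.adL.comp (G.clm G.degreeInv)) 0 := by
  have h : G.frameL = fun u => ContinuousLinearMap.id ℝ _ +
      ∑ s ∈ Finset.range G.depth, G.clm (G.frameAux u (s + 1)) := by
    funext u
    have h1 : G.frame u = ∑ s ∈ Finset.range (G.depth + 1), G.frameAux u s := by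
      ext v; rw [G.frame_apply u v (Nat.le_succ _), LinearMap.sum_apply]
    have h2 : G.frameL u = G.clm (∑ s ∈ Finset.range (G.depth + 1), G.frameAux u s) :=
      congrArg G.clm h1
    rw [h2, map_sum, Finset.sum_range_succ', add_comm]
    exact congrArg (· + _) (G.clm_frameAux_zero u)
  have h3 : G.degreeInv = ∑ s ∈ Finset.range G.depth, ((s : ℝ) + 1)⁻¹ • G.proj (s + 1) := by
    have h4 : G.proj G.depth = 0 := by
      ext v
      have h5 := G.proj_mem G.depth v
      rwa [G.piece_eq_bot le_rfl, Submodule.mem_bot] at h5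
    have h5 := Finset.sum_range_succ (fun i : ℕ => (i : ℝ)⁻¹ • G.proj i) G.depth
    rw [h4, smul_zero, add_zero] at h5
    rw [degreeInv, ← h5, Finset.sum_range_succ']
    simp
  rw [h]
  refine ((HasFDerivAt.fun_sum fun s _ => G.hasFDerivAt_frameAux s).const_add _).congr_fderiv ?_
  rw [h3, map_sum]
  ext x y
  simp

theorem lieBracket_frameL (v w : G.Space) :
    VectorField.lieBracket ℝ (fun u => G.frameL u v) (fun u => G.frameL u w) 0 =
      G.adL (G.clm G.degreeInv v) w - G.adL (G.clm G.degreeInv w) v := by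
  have h0 : ∀ x, G.frameL 0 x = x := fun x => congrArg (fun L : 𝔪 →ₗ[ℝ] 𝔪 => L x) G.frame_zero
  have h1 : ∀ x, HasFDerivAt (fun u => G.frameL u x)
      ((G.adL.comp (G.clm G.degreeInv)).flip x) 0 := fun x => by
    have := G.hasFDerivAt_frameL.clm_apply (hasFDerivAt_const x (0 : G.Space))
    simpa using this
  rw [VectorField.lieBracket, (h1 w).fderiv, (h1 v).fderiv, h0, h0]
  rfl

theorem mlieBracket_mulInvariant (v w : G.Space) :
    VectorField.mlieBracket 𝓘(ℝ, G.Space)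
      (mulInvariantVectorField (I := 𝓘(ℝ, G.Space)) (G := G.FlatModel) v)
      (mulInvariantVectorField (I := 𝓘(ℝ, G.Space)) (G := G.FlatModel) w) 1 =
      VectorField.lieBracket ℝ (fun u => G.frameL u v) (fun u => G.frameL u w) 0 := by
  rw [funext (G.mulInvariantVectorField_eq v), funext (G.mulInvariantVectorField_eq w)]
  have h := congrFun (VectorField.mlieBracketWithin_eq_lieBracketWithin (𝕜 := ℝ) (E := G.Space)
    (V := fun u => G.frameL u v) (W := fun u => G.frameL u w) (s := Set.univ)) 0
  rw [VectorField.lieBracketWithin_univ] at h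
  exact (congrFun (VectorField.mlieBracketWithin_univ) _).symm.trans h

/-- The Lie algebra of the group `G.FlatModel` is `𝔪`; the identification is `degree`, under the
identification of the tangent space at `1` with `𝔪`. -/
def lieEquiv : 𝔪 ≃ₗ⁅ℝ⁆ GroupLieAlgebra 𝓘(ℝ, G.Space) G.FlatModel :=
  { (G.degreeEquiv.trans G.toSpace : 𝔪 ≃ₗ[ℝ] G.Space) with
    map_lie' := by
      intro X Y
      have h1 : G.degree ⁅X, Y⁆ = ⁅X, G.degree Y⁆ - ⁅Y, G.degree X⁆ := by
        rw [G.degree_lie, ← lie_skew (G.degree X)]; abel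
      have h2 := G.lieBracket_frameL (G.degree X) (G.degree Y)
      have h3 : G.adL (G.clm G.degreeInv (G.degree X)) (G.degree Y) -
          G.adL (G.clm G.degreeInv (G.degree Y)) (G.degree X) =
          (⁅X, G.degree Y⁆ - ⁅Y, G.degree X⁆ : 𝔪) := by
        change (⁅G.degreeInv (G.degree X), G.degree Y⁆ -
          ⁅G.degreeInv (G.degree Y), G.degree X⁆ : 𝔪) = _
        rw [degreeInv_degree, degreeInv_degree]
      have h4 := G.mlieBracket_mulInvariant (G.degree X) (G.degree Y)
      exact h1.trans (h4.trans (h2.trans h3)).symm }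

end NegGrading

/-! ### The Carnot algebra as a graded Lie algebra -/

namespace TangentDistribution

variable {E : Type*} [NormedAddCommGroup E] [NormedSpace ℝ E] [FiniteDimensional ℝ E]
  {M : Type*} [TopologicalSpace M] [ChartedSpace E M] [IsManifold 𝓘(ℝ, E) ∞ M]
  (Δ : TangentDistribution E M)

/-- The projection of the Carnot algebra onto the component `g_{-i}(x)`. -/
def carnotComponent (x : M) (i : ℕ) : Δ.Carnot x →ₗ[ℝ] Δ.CarnotPiece x i :=
  DirectSum.component ℝ ℕ (Δ.CarnotPiece x) i

theorem carnotComponent_cls (x : M) (i : ℕ) (X : Δ.flagSections i) :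
    Δ.carnotComponent x i (Δ.cls x i X) = Δ.pieceMk x i X :=
  DirectSum.component.lof_self (R := ℝ) (M := Δ.CarnotPiece x) i (Δ.pieceMk x i X)

theorem carnotComponent_cls_ne (x : M) {i j : ℕ} (h : j ≠ i) (X : Δ.flagSections j) :
    Δ.carnotComponent x i (Δ.cls x j X) = 0 := by
  refine (DirectSum.component.of (R := ℝ) (M := Δ.CarnotPiece x) i j (Δ.pieceMk x j X)).trans ?_
  rw [dif_neg h]

/-- The grading of the Carnot algebra, with components `g_{-i}(x)`. -/
def carnotGrading (x : M) : NegGrading (Δ.Carnot x) where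
  piece i := LinearMap.range (Δ.cls x i)
  piece_zero := by
    refine (LinearMap.range_eq_bot).2 (LinearMap.ext fun X => ?_)
    exact Δ.cls_eq_zero x (Submodule.mem_sup_left X.2)
  lie_mem := by
    rintro i j _ _ ⟨X, rfl⟩ ⟨Y, rfl⟩
    exact ⟨_, (Δ.lie_cls x i j X Y).symm⟩
  isInternal := by
    rw [DirectSum.isInternal_submodule_iff_iSupIndep_and_iSup_eq_top]
    constructor
    · intro i
      rw [Submodule.disjoint_def]
      rintro _ ⟨X, rfl⟩ hX
      have h : (⨆ (j : ℕ) (_ : j ≠ i), LinearMap.range (Δ.cls x j)) ≤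
          LinearMap.ker (Δ.carnotComponent x i) := by
        refine iSup₂_le fun j hj => ?_
        rintro _ ⟨Y, rfl⟩
        exact Δ.carnotComponent_cls_ne x hj Y
      have h1 : Δ.carnotComponent x i (Δ.cls x i X) = 0 := h hX
      rw [carnotComponent_cls] at h1
      change DirectSum.lof ℝ ℕ (Δ.CarnotPiece x) i (Δ.pieceMk x i X) = 0
      rw [h1, map_zero]
    · refine eq_top_iff.2 fun a _ => ?_
      induction a using Δ.carnot_induction x with
      | zero => exact Submodule.zero_mem _
      | add a b ha hb => exact Submodule.add_mem _ (ha trivial) (hb trivial)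
      | cls i X => exact Submodule.mem_iSup_of_mem i ⟨X, rfl⟩

end TangentDistribution

/-! ### Flat models -/

namespace NegGrading

variable {𝔪 : Type*} [LieRing 𝔪] [LieAlgebra ℝ 𝔪] [FiniteDimensional ℝ 𝔪] (G : NegGrading 𝔪)

/-- `X ↦` the value at `u` of the left invariant vector field on the group `G.FlatModel` that
corresponds to `X ∈ 𝔪`. -/
def leftInvariant (u : G.FlatModel) : 𝔪 →ₗ[ℝ] TangentSpace 𝓘(ℝ, G.Space) u where
  toFun X := mulInvariantVectorField (G.lieEquiv X) u
  map_add' X Y := by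
    rw [map_add, mulInvariantVectorField_add]; rfl
  map_smul' c X := by
    rw [map_smul, mulInvariantVectorField_smul]; rfl

theorem leftInvariant_apply (u : G.FlatModel) (X : 𝔪) :
    G.leftInvariant u X = G.frameL (G.toModel.symm u) (G.toSpace (G.degree X)) :=
  G.mulInvariantVectorField_eq _ _

theorem leftInvariant_injective (u : G.FlatModel) : Function.Injective (G.leftInvariant u) := by
  intro X Y h
  rw [leftInvariant_apply, leftInvariant_apply] at h
  exact G.degree_injective (G.frame_injective _ h)

/-- The left invariant vector field that corresponds to `X ∈ 𝔪`. -/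
def leftInvariantField (X : 𝔪) : SmoothVF G.Space G.FlatModel :=
  ⟨fun u => G.leftInvariant u X, by
    have h : ContDiff ℝ ∞ (fun u : G.Space => G.frameL u (G.toSpace (G.degree X))) :=
      (G.contDiff_frameL ∞).clm_apply contDiff_const
    have h1 : ContMDiff 𝓘(ℝ, G.Space) 𝓘(ℝ, G.Space).tangent ∞
        (fun u : G.Space => (⟨u, G.frameL u (G.toSpace (G.degree X))⟩ :
          TangentBundle 𝓘(ℝ, G.Space) G.Space)) :=
      contMDiff_vectorSpace_iff_contDiff.2 h
    have h2 : (fun u : G.FlatModel => G.leftInvariant u X) =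
        fun u => G.frameL (G.toModel.symm u) (G.toSpace (G.degree X)) :=
      funext fun u => G.leftInvariant_apply u X
    change ContMDiff 𝓘(ℝ, G.Space) 𝓘(ℝ, G.Space).tangent ∞
      (fun u => (⟨u, (fun u : G.FlatModel => G.leftInvariant u X) u⟩ :
        TangentBundle 𝓘(ℝ, G.Space) G.FlatModel))
    rw [h2]
    exact h1⟩

/-- The flat model: the left invariant distribution on the group `G.FlatModel` that is spanned by
the left invariant vector fields in `g_{-1}`. -/
def flatDistribution : TangentDistribution G.Space G.FlatModel where
  space u := (G.piece 1).map (G.leftInvariant u)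
  finrank_eq u v :=
    (Submodule.equivMapOfInjective _ (G.leftInvariant_injective u) (G.piece 1)).finrank_eq.symm.trans
      (Submodule.equivMapOfInjective _ (G.leftInvariant_injective v) (G.piece 1)).finrank_eq
  exists_section := by
    rintro u _ ⟨X, hX, rfl⟩
    exact ⟨G.leftInvariantField X, fun v => ⟨X, hX, rfl⟩, rfl⟩

end NegGrading

/-! ### Integrable extensions and central extensions -/

/-- `π : (M', Δ') → (M, Δ)` is an integrable extension: a smooth submersion such that `dπ` maps
`Δ'` isomorphically onto `Δ` and the derived distribution `Δ'_2` meets `ker dπ` trivially. -/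
structure IsIntegrableExtension
    {E' : Type*} [NormedAddCommGroup E'] [NormedSpace ℝ E'] [FiniteDimensional ℝ E']
    {M' : Type*} [TopologicalSpace M'] [ChartedSpace E' M'] [IsManifold 𝓘(ℝ, E') ∞ M']
    {E : Type*} [NormedAddCommGroup E] [NormedSpace ℝ E]
    {M : Type*} [TopologicalSpace M] [ChartedSpace E M] [IsManifold 𝓘(ℝ, E) ∞ M]
    (Δ' : TangentDistribution E' M') (Δ : TangentDistribution E M) (π : M' → M) : Prop where
  contMDiff : ContMDiff 𝓘(ℝ, E') 𝓘(ℝ, E) ∞ π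
  submersion : ∀ x, Function.Surjective (mfderiv 𝓘(ℝ, E') 𝓘(ℝ, E) π x)
  bijOn : ∀ x, Set.BijOn (mfderiv 𝓘(ℝ, E') 𝓘(ℝ, E) π x) (Δ'.space x) (Δ.space (π x))
  flag_two : ∀ x, Disjoint (Δ'.flag 2 x)
    (LinearMap.ker (mfderiv 𝓘(ℝ, E') 𝓘(ℝ, E) π x).toLinearMap)

/-- `p : 𝔫 → 𝔪` exhibits the graded Lie algebra `𝔫` as a `d`-dimensional central extension of the
graded Lie algebra `𝔪` of pure grading `-k`: the sequence `0 → ker p → 𝔫 → 𝔪 → 0` is exact, `p` is a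
morphism of graded Lie algebras, and `ker p` is central, `d`-dimensional and contained in the
component of degree `-k`. -/
structure IsCentralExtension {𝔫 𝔪 : Type*} [LieRing 𝔫] [LieAlgebra ℝ 𝔫] [LieRing 𝔪]
    [LieAlgebra ℝ 𝔪] (H : NegGrading 𝔫) (G : NegGrading 𝔪) (d k : ℕ) (p : 𝔫 →ₗ⁅ℝ⁆ 𝔪) : Prop where
  surjective : Function.Surjective p
  map_piece : ∀ i, ∀ X ∈ H.piece i, p X ∈ G.piece i
  ker_central : p.ker ≤ LieAlgebra.center ℝ 𝔫
  rank_ker : Module.rank ℝ p.ker = d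
  ker_le_piece : ∀ X ∈ p.ker, X ∈ H.piece k

/-- The extension `p : 𝔫 → 𝔪` is trivial: the exact sequence of Lie algebras splits. -/
def IsTrivialExtension {𝔫 𝔪 : Type*} [LieRing 𝔫] [LieAlgebra ℝ 𝔫] [LieRing 𝔪]
    [LieAlgebra ℝ 𝔪] (p : 𝔫 →ₗ⁅ℝ⁆ 𝔪) : Prop :=
  ∃ s : 𝔪 →ₗ⁅ℝ⁆ 𝔫, ∀ X, p (s X) = X

end

/-! From integrable to central extensions. For a regular distribution a section of Δ_i dies in the
fibre g_{-i}(x) exactly when its value at x lies in Δ_{i-1}(x) (`mem_fiberKer_iff`), so g_{-i}(x) is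
Δ_i(x)/Δ_{i-1}(x) and a linear map of Carnot algebras can be defined through dπ on values. Since dπ
identifies Δ' with Δ, sections of Δ_i lift to π-related sections of Δ'_i (`exists_lift`). Conversely
Γ(Δ'_i) is locally generated, over functions on M', by fields related to sections of Δ_i
(`flagSections_le_germSpan`). Hence dπ maps Δ'_i(x) onto Δ_i(π(x)) (`map_flag`), and every class
upstairs has a projectable representative. On such representatives the induced map respects
brackets, because commutators of related fields are related (`exists_carnotMap`).

A class of degree -i in the kernel has a value that is vertical modulo Δ'_{i-1}(x). Pure grading
leaves no room for this unless i = k: for i < k the vertical part is zero, for i > k it already lies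
in Δ'_{i-1}(x). In degree -k the kernel is a copy of the vertical space. An ideal contained in one
degree is central, since bracketing with a homogeneous element shifts the degree
(`lieIdeal_le_center`).

From central to integrable extensions. The flat model has the product u * v = u + A_u v, where A_u
is built from brackets and graded projections alone. A graded homomorphism p commutes with these
(`map_frame`), so the linear map p is itself the group homomorphism and carries left-invariant
fields to left-invariant fields. The distribution upstairs is the left translate of g_{-1}, and its
derived distribution lies in that of g_{-1} + g_{-2} (`flatDistribution_flag_two_le`). The kernel of
p sits in g_{-k} with k > 2 and meets both trivially. -/

set_option linter.unusedSectionVars false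

/-! ### Smooth coefficients with respect to independent fields, and cutoffs. -/

section SmoothCoefficients

open Filter Bundle
open scoped Topology

variable {E : Type*} [NormedAddCommGroup E] [NormedSpace ℝ E]
  {M : Type*} [TopologicalSpace M] [ChartedSpace E M]
  {F : Type*} [NormedAddCommGroup F] [NormedSpace ℝ F] [FiniteDimensional ℝ F]

/-- The coefficients of a smooth function with respect to smooth linearly independent functions
whose span contains it are smooth. -/
theorem exists_contMDiffAt_coeff {n : ℕ} (A : Fin n → M → F) (b : M → F) (x : M)
    (hA : ∀ i, ∀ᶠ z in 𝓝 x, ContMDiffAt 𝓘(ℝ, E) 𝓘(ℝ, F) ∞ (A i) z)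
    (hb : ∀ᶠ z in 𝓝 x, ContMDiffAt 𝓘(ℝ, E) 𝓘(ℝ, F) ∞ b z)
    (hli : LinearIndependent ℝ fun i => A i x) :
    ∃ f : Fin n → M → ℝ, ∀ᶠ z in 𝓝 x, (∀ i, ContMDiffAt 𝓘(ℝ, E) 𝓘(ℝ, ℝ) ∞ (f i) z) ∧
      (LinearIndependent ℝ fun i => A i z) ∧
      (b z ∈ Submodule.span ℝ (Set.range fun i => A i z) → b z = ∑ i, f i z • A i z) := by
  -- A left inverse of the frame at `x` turns the system `∑ c j • A j z = b z` into a square one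
  -- whose operator `T z` is the identity at `z = x`, hence invertible nearby.
  obtain ⟨L₀, hL₀⟩ := (Fintype.linearCombination ℝ (fun i => A i x)).exists_leftInverse_of_injective
    (LinearMap.ker_eq_bot.2 (linearIndependent_iff_injective_fintypeLinearCombination.1 hli))
  let L : F →L[ℝ] (Fin n → ℝ) := LinearMap.toContinuousLinearMap L₀
  -- `Φ` assembles columns into an operator. It is linear, so `T` is smooth wherever the `A j` are.
  let Φ : (Fin n → (Fin n → ℝ)) →L[ℝ] ((Fin n → ℝ) →L[ℝ] (Fin n → ℝ)) :=
    LinearMap.toContinuousLinearMap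
      ((LinearMap.toContinuousLinearMap (𝕜 := ℝ) (E := Fin n → ℝ) (F' := Fin n → ℝ)).toLinearMap ∘ₗ
        Fintype.bilinearCombination ℝ ℝ)
  let T : M → ((Fin n → ℝ) →L[ℝ] (Fin n → ℝ)) := fun z => Φ fun j => L (A j z)
  have hT : ∀ z c, T z c = L (∑ j, c j • A j z) := by
    intro z c
    change Fintype.linearCombination ℝ (fun j => L (A j z)) c = _
    simp [Fintype.linearCombination_apply]
  have hTx : T x = ((ContinuousLinearEquiv.refl ℝ (Fin n → ℝ) :
      (Fin n → ℝ) ≃L[ℝ] (Fin n → ℝ)) : (Fin n → ℝ) →L[ℝ] (Fin n → ℝ)) := by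
    ext1 c
    rw [hT]
    exact congrArg (fun l : (Fin n → ℝ) →ₗ[ℝ] (Fin n → ℝ) => l c) hL₀
  have hTs : ∀ᶠ z in 𝓝 x, ContMDiffAt 𝓘(ℝ, E) 𝓘(ℝ, (Fin n → ℝ) →L[ℝ] (Fin n → ℝ)) ∞ T z := by
    filter_upwards [eventually_all.2 hA] with z hz
    exact Φ.contDiff.contDiffAt.comp_contMDiffAt (contMDiffAt_pi_space.2 fun i =>
      L.contDiff.contDiffAt.comp_contMDiffAt (hz i))
  have hinv : ∀ᶠ z in 𝓝 x, ∃ e : (Fin n → ℝ) ≃L[ℝ] (Fin n → ℝ),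
      (e : (Fin n → ℝ) →L[ℝ] (Fin n → ℝ)) = T z :=
    hTs.self_of_nhds.continuousAt.eventually_mem (hTx ▸ ContinuousLinearEquiv.nhds _)
  -- `ContinuousLinearMap.inverse` has the default value zero at non-invertible operators; only
  -- points near `x`, where `T z` is invertible, matter.
  refine ⟨fun i z => (T z).inverse (L (b z)) i, ?_⟩
  filter_upwards [hTs, hinv, hb] with z hz ⟨e, he⟩ hbz
  have hl : ∀ c, e c = L (∑ j, c j • A j z) := fun c => by
    rw [← hT, ← he]; rfl
  refine ⟨?_, ?_, ?_⟩
  · have h1 : ContMDiffAt 𝓘(ℝ, E) 𝓘(ℝ, (Fin n → ℝ) →L[ℝ] (Fin n → ℝ)) ∞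
        (fun z => (T z).inverse) z :=
      ContDiffAt.comp_contMDiffAt (g := ContinuousLinearMap.inverse)
        (he ▸ contDiffAt_map_inverse e) hz
    exact contMDiffAt_pi_space.1 (h1.clm_apply (L.contDiff.contDiffAt.comp_contMDiffAt hbz))
  · rw [Fintype.linearIndependent_iff]
    intro c hc
    have : e c = 0 := by rw [hl, hc, map_zero]
    exact congrFun (e.map_eq_zero_iff.1 this)
  · intro hm
    obtain ⟨c, hc⟩ := (Submodule.mem_span_range_iff_exists_fun ℝ).1 hm
    have h1 : (T z).inverse (L (b z)) = c := by
      rw [← he, ContinuousLinearMap.inverse_equiv, ← hc, ← hl]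
      exact e.symm_apply_apply c
    simp only [h1]
    exact hc.symm

variable [IsManifold 𝓘(ℝ, E) ∞ M]

section Global

variable [FiniteDimensional ℝ E] [T2Space M]

/-- Bump functions in a chart extend by zero to smooth functions on a Hausdorff manifold;
paracompactness plays no role. -/
theorem exists_smooth_cutoff {x : M} {s : Set M} (hs : s ∈ 𝓝 x) :
    ∃ h : C^∞⟮𝓘(ℝ, E), M; ℝ⟯, h =ᶠ[𝓝 x] 1 ∧ tsupport h ⊆ s := by
  obtain ⟨χ, hχ⟩ := (SmoothBumpFunction.nhds_basis_support (I := 𝓘(ℝ, E)) hs).ex_mem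
  exact ⟨⟨χ, χ.contMDiff⟩, χ.eventuallyEq_one, hχ⟩

/-- A germ of a smooth function extends to a smooth function. -/
theorem exists_smooth_extension {x : M} {f : M → ℝ}
    (hf : ∀ᶠ z in 𝓝 x, ContMDiffAt 𝓘(ℝ, E) 𝓘(ℝ, ℝ) ∞ f z) :
    ∃ g : C^∞⟮𝓘(ℝ, E), M; ℝ⟯, g =ᶠ[𝓝 x] f := by
  obtain ⟨h, h1, h2⟩ := exists_smooth_cutoff (E := E) hf
  refine ⟨⟨fun z => h z * f z, contMDiff_of_tsupport fun z hz => ?_⟩, ?_⟩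
  · exact h.contMDiff.contMDiffAt.mul (h2 (tsupport_mul_subset_left hz))
  · filter_upwards [h1] with z hz
    change h z * f z = f z
    rw [hz, Pi.one_apply, one_mul]

end Global

section Along

variable {E' : Type*} [NormedAddCommGroup E'] [NormedSpace ℝ E']
  {M' : Type*} [TopologicalSpace M'] [ChartedSpace E' M'] [IsManifold 𝓘(ℝ, E') ∞ M']
  [FiniteDimensional ℝ E]

/-- Linear independence of vector fields along a smooth map is an open condition, and the
coefficients with respect to such fields are smooth. -/
theorem exists_coeff_along (g : M' → M) (hg : Continuous g) {n : ℕ}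
    (V : Fin n → ∀ z, TangentSpace 𝓘(ℝ, E) (g z)) (U : ∀ z, TangentSpace 𝓘(ℝ, E) (g z))
    (hV : ∀ i, ContMDiff 𝓘(ℝ, E') 𝓘(ℝ, E).tangent ∞
      fun z => (⟨g z, V i z⟩ : TangentBundle 𝓘(ℝ, E) M))
    (hU : ContMDiff 𝓘(ℝ, E') 𝓘(ℝ, E).tangent ∞ fun z => (⟨g z, U z⟩ : TangentBundle 𝓘(ℝ, E) M))
    (x : M') (hli : LinearIndependent ℝ fun i => V i x) :
    ∃ f : Fin n → M' → ℝ, ∀ᶠ z in 𝓝 x, (∀ i, ContMDiffAt 𝓘(ℝ, E') 𝓘(ℝ, ℝ) ∞ (f i) z) ∧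
      (LinearIndependent ℝ fun i => V i z) ∧
      (U z ∈ Submodule.span ℝ (Set.range fun i => V i z) → U z = ∑ i, f i z • V i z) := by
  -- In a trivialization of the tangent bundle near `g x`, fields along `g` become functions with
  -- values in the fixed space `E`.
  let e := trivializationAt E (TangentSpace 𝓘(ℝ, E) : M → Type _) (g x)
  have hbase : ∀ᶠ z in 𝓝 x, g z ∈ e.baseSet :=
    hg.continuousAt.eventually_mem (e.open_baseSet.mem_nhds (mem_baseSet_trivializationAt _ _ _))
  let ψ : ∀ z, TangentSpace 𝓘(ℝ, E) (g z) →L[ℝ] E := fun z => e.continuousLinearMapAt ℝ (g z)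
  have hψ : ∀ z, g z ∈ e.baseSet → Function.Injective (ψ z) := fun z hz => by
    have h := (e.continuousLinearEquivAt ℝ (g z) hz).injective
    rwa [e.coe_continuousLinearEquivAt_eq] at h
  have hsm : ∀ W : ∀ z, TangentSpace 𝓘(ℝ, E) (g z),
      (ContMDiff 𝓘(ℝ, E') 𝓘(ℝ, E).tangent ∞
        fun z => (⟨g z, W z⟩ : TangentBundle 𝓘(ℝ, E) M)) →
      ∀ᶠ z in 𝓝 x, ContMDiffAt 𝓘(ℝ, E') 𝓘(ℝ, E) ∞ (fun z => ψ z (W z)) z := by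
    intro W hW
    filter_upwards [eventually_eventually_nhds.2 hbase] with z hz
    have h1 : ContMDiffAt 𝓘(ℝ, E).tangent (𝓘(ℝ, E).prod 𝓘(ℝ, E)) ∞ e
        (⟨g z, W z⟩ : TangentBundle 𝓘(ℝ, E) M) :=
      (e.contMDiffOn (n := ∞) (IB := 𝓘(ℝ, E))).contMDiffAt
        (e.open_source.mem_nhds (e.mem_source.2 hz.self_of_nhds))
    have h2 := contMDiffAt_snd.comp z (h1.comp z hW.contMDiffAt)
    refine h2.congr_of_eventuallyEq ?_
    filter_upwards [hz] with w hw
    change e.continuousLinearMapAt ℝ (g w) (W w) = (e ⟨g w, W w⟩).2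
    rw [e.continuousLinearMapAt_apply (R := ℝ), e.coe_linearMapAt_of_mem hw]
  obtain ⟨f, hf⟩ := exists_contMDiffAt_coeff (E := E') (fun i z => ψ z (V i z)) (fun z => ψ z (U z)) x
    (fun i => hsm _ (hV i)) (hsm _ hU)
    (hli.map' (ψ x).toLinearMap (LinearMap.ker_eq_bot.2 (hψ x hbase.self_of_nhds)))
  refine ⟨f, ?_⟩
  filter_upwards [hf, hbase] with z ⟨h1, h2, h3⟩ hz
  refine ⟨h1, LinearIndependent.of_comp (ψ z).toLinearMap h2, fun hm => hψ z hz ?_⟩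
  have h4 : ψ z (U z) ∈ Submodule.span ℝ (Set.range fun i => ψ z (V i z)) := by
    have := Submodule.mem_map_of_mem (f := (ψ z).toLinearMap) hm
    rw [Submodule.map_span, ← Set.range_comp] at this
    exact this
  rw [h3 h4, map_sum]
  simp

/-- The coefficients of a smooth vector field along a smooth map, with respect to linearly
independent such fields whose span contains it, extend to smooth functions. -/
theorem exists_smooth_coeff_along [FiniteDimensional ℝ E'] [T2Space M'] (g : M' → M)
    (hg : Continuous g) {n : ℕ}
    (V : Fin n → ∀ z, TangentSpace 𝓘(ℝ, E) (g z)) (U : ∀ z, TangentSpace 𝓘(ℝ, E) (g z))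
    (hV : ∀ i, ContMDiff 𝓘(ℝ, E') 𝓘(ℝ, E).tangent ∞
      fun z => (⟨g z, V i z⟩ : TangentBundle 𝓘(ℝ, E) M))
    (hU : ContMDiff 𝓘(ℝ, E') 𝓘(ℝ, E).tangent ∞ fun z => (⟨g z, U z⟩ : TangentBundle 𝓘(ℝ, E) M))
    (x : M') (hli : LinearIndependent ℝ fun i => V i x) :
    ∃ f : Fin n → C^∞⟮𝓘(ℝ, E'), M'; ℝ⟯, ∀ᶠ z in 𝓝 x,
      (LinearIndependent ℝ fun i => V i z) ∧
      (U z ∈ Submodule.span ℝ (Set.range fun i => V i z) → U z = ∑ i, f i z • V i z) := by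
  obtain ⟨f, hf⟩ := exists_coeff_along g hg V U hV hU x hli
  choose h hh using fun i => exists_smooth_extension (hf.mono fun z hz => hz.1 i)
  refine ⟨h, ?_⟩
  filter_upwards [hf, eventually_all.2 hh] with z hz hz'
  refine ⟨hz.2.1, fun hm => (hz.2.2 hm).trans ?_⟩
  simp only [hz']

end Along

end SmoothCoefficients

/-! ### Calculus of vector fields: derivations, related fields, spans over functions, frames. -/

namespace SmoothVF

open Filter
open scoped Topology

variable {E : Type*} [NormedAddCommGroup E] [NormedSpace ℝ E] [FiniteDimensional ℝ E]
  {M : Type*} [TopologicalSpace M] [ChartedSpace E M] [IsManifold 𝓘(ℝ, E) ∞ M]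

/-! ### Vector fields as derivations -/

/-- The Leibniz and Jacobi rules force this without coordinates: expanding `⁅⁅X, Y⁆, f Z⁆` in two
ways shows that the difference of the two sides kills `Z.1 x` for every field `Z`. Some `Z` among
`X`, `Y`, `⁅X, Y⁆` is nonzero at `x`, unless all three vanish there, and then both sides are zero.
-/
theorem deriv_lie (X Y : SmoothVF E M) (f : C^∞⟮𝓘(ℝ, E), M; ℝ⟯) (x : M) :
    deriv ⁅X, Y⁆ f x = deriv X (deriv Y f) x - deriv Y (deriv X f) x := by
  have key : ∀ Z : SmoothVF E M,
      (deriv ⁅X, Y⁆ f x - (deriv X (deriv Y f) x - deriv Y (deriv X f) x)) • Z.1 x = 0 := by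
    intro Z
    have h := lie_lie X Y (fsmul f Z)
    simp only [lie_fsmul, lie_add, lie_lie X Y Z] at h
    have h1 := congrFun (congrArg Subtype.val h) x
    change deriv ⁅X, Y⁆ f x • Z.1 x + f x • ((⁅X, ⁅Y, Z⁆⁆ : SmoothVF E M).1 x -
        (⁅Y, ⁅X, Z⁆⁆ : SmoothVF E M).1 x) =
      (deriv X (deriv Y f) x • Z.1 x + deriv Y f x • (⁅X, Z⁆ : SmoothVF E M).1 x +
        (deriv X f x • (⁅Y, Z⁆ : SmoothVF E M).1 x + f x • (⁅X, ⁅Y, Z⁆⁆ : SmoothVF E M).1 x)) -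
      (deriv Y (deriv X f) x • Z.1 x + deriv X f x • (⁅Y, Z⁆ : SmoothVF E M).1 x +
        (deriv Y f x • (⁅X, Z⁆ : SmoothVF E M).1 x + f x • (⁅Y, ⁅X, Z⁆⁆ : SmoothVF E M).1 x)) at h1
    refine Eq.trans ?_ (sub_eq_zero.2 h1)
    module
  have hz : ∀ (Z : SmoothVF E M) (g : C^∞⟮𝓘(ℝ, E), M; ℝ⟯), Z.1 x = 0 → deriv Z g x = 0 := by
    intro Z g h
    change mvfderiv 𝓘(ℝ, E) g x (Z.1 x) = 0
    rw [h, map_zero]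
  by_cases hX : X.1 x = 0
  · by_cases hY : Y.1 x = 0
    · by_cases hXY : (⁅X, Y⁆ : SmoothVF E M).1 x = 0
      · rw [hz _ _ hX, hz _ _ hY, hz _ _ hXY, sub_zero]
      · exact sub_eq_zero.1 ((smul_eq_zero.1 (key _)).resolve_right hXY)
    · exact sub_eq_zero.1 ((smul_eq_zero.1 (key _)).resolve_right hY)
  · exact sub_eq_zero.1 ((smul_eq_zero.1 (key _)).resolve_right hX)

/-- Smooth functions separate tangent vectors. -/
theorem _root_.TangentSpace.eq_of_mvfderiv_eq [T2Space M] {x : M} {v w : TangentSpace 𝓘(ℝ, E) x}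
    (h : ∀ f : C^∞⟮𝓘(ℝ, E), M; ℝ⟯, mvfderiv 𝓘(ℝ, E) f x v = mvfderiv 𝓘(ℝ, E) f x w) : v = w := by
  have : IsManifold 𝓘(ℝ, E) 1 M := IsManifold.of_le (n := ∞) (by simp)
  have hinj : Function.Injective (mfderiv 𝓘(ℝ, E) 𝓘(ℝ, E) (extChartAt 𝓘(ℝ, E) x) x) :=
    (isInvertible_mfderiv_extChartAt (I := 𝓘(ℝ, E)) (mem_extChartAt_source x)).bijective.injective
  refine hinj ((Module.forall_dual_apply_eq_zero_iff ℝ _).1 ?_ |> sub_eq_zero.1)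
  intro l
  -- The test functions are linear functionals of the chart at `x`, extended to `M` by a cutoff;
  -- they suffice because the chart has invertible differential.
  let L : E →L[ℝ] ℝ := LinearMap.toContinuousLinearMap (E := E) l
  obtain ⟨f, hf⟩ := exists_smooth_extension (E := E) (x := x)
    (f := fun z => L (extChartAt 𝓘(ℝ, E) x z)) (by
      filter_upwards [(chartAt E x).open_source.mem_nhds (mem_chart_source E x)] with z hz
      exact L.contDiff.contDiffAt.comp_contMDiffAt
        (contMDiffOn_extChartAt.contMDiffAt ((chartAt E x).open_source.mem_nhds hz)))
  have hd : ∀ u : TangentSpace 𝓘(ℝ, E) x, mvfderiv 𝓘(ℝ, E) f x u =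
      L (mfderiv 𝓘(ℝ, E) 𝓘(ℝ, E) (extChartAt 𝓘(ℝ, E) x) x u) := by
    intro u
    change mfderiv 𝓘(ℝ, E) 𝓘(ℝ, ℝ) f x u = _
    rw [hf.mfderiv_eq]
    have h1 : MDifferentiableAt 𝓘(ℝ, E) 𝓘(ℝ, E) (extChartAt 𝓘(ℝ, E) x) x :=
      mdifferentiableAt_extChartAt (mem_chart_source E x)
    have h2 := (L.hasMFDerivAt.comp x h1.hasMFDerivAt).mfderiv
    exact congrArg (fun A : TangentSpace 𝓘(ℝ, E) x →L[ℝ] ℝ => A u) h2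
  have h3 := h f
  rw [hd, hd] at h3
  exact (map_sub L _ _).trans (sub_eq_zero.2 h3)

section Related

variable {E' : Type*} [NormedAddCommGroup E'] [NormedSpace ℝ E'] [FiniteDimensional ℝ E']
  {M' : Type*} [TopologicalSpace M'] [ChartedSpace E' M'] [IsManifold 𝓘(ℝ, E') ∞ M']

variable {π : M' → M} {X' Y' : SmoothVF E' M'} {X Y : SmoothVF E M}

/-- The vector fields `X'` and `X` are `π`-related. -/
def IsRelated (π : M' → M) (X' : SmoothVF E' M') (X : SmoothVF E M) : Prop :=
  ∀ y, mfderiv 𝓘(ℝ, E') 𝓘(ℝ, E) π y (X'.1 y) = X.1 (π y)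

theorem IsRelated.add (hX : IsRelated π X' X) (hY : IsRelated π Y' Y) :
    IsRelated π (X' + Y') (X + Y) := fun y => by
  change mfderiv 𝓘(ℝ, E') 𝓘(ℝ, E) π y (X'.1 y + Y'.1 y) = X.1 (π y) + Y.1 (π y)
  rw [map_add, hX, hY]

theorem IsRelated.smul (c : ℝ) (hX : IsRelated π X' X) : IsRelated π (c • X') (c • X) := fun y => by
  change mfderiv 𝓘(ℝ, E') 𝓘(ℝ, E) π y (c • X'.1 y) = c • X.1 (π y)
  rw [map_smul, hX]

theorem isRelated_zero (π : M' → M) : IsRelated π (0 : SmoothVF E' M') (0 : SmoothVF E M) :=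
  fun _ => map_zero _

theorem mvfderiv_comp_apply (hπ : ContMDiff 𝓘(ℝ, E') 𝓘(ℝ, E) ∞ π) (f : C^∞⟮𝓘(ℝ, E), M; ℝ⟯) (y : M')
    (v : TangentSpace 𝓘(ℝ, E') y) :
    mvfderiv 𝓘(ℝ, E') (fun z => f (π z)) y v =
      mvfderiv 𝓘(ℝ, E) f (π y) (mfderiv 𝓘(ℝ, E') 𝓘(ℝ, E) π y v) := by
  have h := mfderiv_comp y ((f.contMDiff (π y)).mdifferentiableAt (by simp))
    ((hπ y).mdifferentiableAt (by simp))
  exact congrArg (fun L : TangentSpace 𝓘(ℝ, E') y →L[ℝ] ℝ => L v) h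

theorem IsRelated.deriv_comp (hπ : ContMDiff 𝓘(ℝ, E') 𝓘(ℝ, E) ∞ π) (hX : IsRelated π X' X)
    (f : C^∞⟮𝓘(ℝ, E), M; ℝ⟯) :
    deriv X' ⟨fun z => f (π z), f.contMDiff.comp hπ⟩ =
      ⟨fun z => deriv X f (π z), (deriv X f).contMDiff.comp hπ⟩ := by
  ext y
  change mvfderiv 𝓘(ℝ, E') (fun z => f (π z)) y (X'.1 y) = mvfderiv 𝓘(ℝ, E) f (π y) (X.1 (π y))
  rw [mvfderiv_comp_apply hπ, hX]

/-- Commutators of related fields are related. -/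
theorem IsRelated.lie [T2Space M] (hπ : ContMDiff 𝓘(ℝ, E') 𝓘(ℝ, E) ∞ π) (hX : IsRelated π X' X)
    (hY : IsRelated π Y' Y) : IsRelated π ⁅X', Y'⁆ ⁅X, Y⁆ := by
  intro y
  -- As derivations, related fields satisfy `X' (f ∘ π) = (X f) ∘ π`, an identity inherited by
  -- commutators.
  refine TangentSpace.eq_of_mvfderiv_eq fun f => ?_
  have h := deriv_lie X' Y' ⟨fun z => f (π z), f.contMDiff.comp hπ⟩ y
  rw [hX.deriv_comp hπ, hY.deriv_comp hπ, hX.deriv_comp hπ, hY.deriv_comp hπ] at h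
  exact ((mvfderiv_comp_apply hπ f y _).symm.trans h).trans (deriv_lie X Y f (π y)).symm

end Related

/-! ### Spans over the ring of smooth functions -/

/-- The span of `S` over the ring of smooth functions. -/
noncomputable def funSpan (S : Submodule ℝ (SmoothVF E M)) : Submodule ℝ (SmoothVF E M) :=
  Submodule.span ℝ {Z | ∃ f, ∃ A ∈ S, Z = fsmul f A}

variable {S T R : Submodule ℝ (SmoothVF E M)}

theorem fsmul_mem_funSpan_of_mem (f : C^∞⟮𝓘(ℝ, E), M; ℝ⟯) {A : SmoothVF E M} (hA : A ∈ S) :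
    fsmul f A ∈ funSpan S := Submodule.subset_span ⟨f, A, hA, rfl⟩

theorem funSpan_mono (h : S ≤ T) : funSpan S ≤ funSpan T :=
  Submodule.span_mono fun _ ⟨f, A, hA, e⟩ => ⟨f, A, h hA, e⟩

theorem fsmul_mem_funSpan (f : C^∞⟮𝓘(ℝ, E), M; ℝ⟯) {A : SmoothVF E M} (hA : A ∈ funSpan S) :
    fsmul f A ∈ funSpan S := by
  have h : funSpan S ≤ (funSpan S).comap (fsmulₗ E M f) := by
    refine Submodule.span_le.2 ?_
    rintro _ ⟨g, A, hA, rfl⟩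
    have e : fsmul f (fsmul g A) = fsmul (f * g) A := by
      ext z; exact (mul_smul _ _ _).symm
    change fsmul f (fsmul g A) ∈ funSpan S
    rw [e]
    exact fsmul_mem_funSpan_of_mem _ hA
  exact h hA

/-- By the Leibniz rule `⁅f A, g B⁆` differs from `f g ⁅A, B⁆` by function multiples of `A` and `B`,
which is why `R` has to contain `S` and `T` as well as the brackets. -/
theorem lie_mem_funSpan (hS : S ≤ R) (hT : T ≤ R) (hST : ∀ A ∈ S, ∀ B ∈ T, ⁅A, B⁆ ∈ R)
    {A B : SmoothVF E M} (hA : A ∈ funSpan S) (hB : B ∈ funSpan T) : ⁅A, B⁆ ∈ funSpan R := by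
  induction hA, hB using Submodule.span_induction₂ with
  | mem_mem A B hA hB =>
    obtain ⟨f, A, hA, rfl⟩ := hA
    obtain ⟨g, B, hB, rfl⟩ := hB
    rw [lie_fsmul, ← lie_skew, lie_fsmul]
    have h1 : ⁅B, A⁆ ∈ R := by rw [← lie_skew]; exact R.neg_mem (hST A hA B hB)
    exact Submodule.add_mem _ (fsmul_mem_funSpan_of_mem _ (hT hB)) (fsmul_mem_funSpan _
      (Submodule.neg_mem _ (Submodule.add_mem _ (fsmul_mem_funSpan_of_mem _ (hS hA))
        (fsmul_mem_funSpan_of_mem _ h1))))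
  | zero_left => simp
  | zero_right => simp
  | add_left _ _ _ _ _ _ h h' => rw [add_lie]; exact Submodule.add_mem _ h h'
  | add_right _ _ _ _ _ _ h h' => rw [lie_add]; exact Submodule.add_mem _ h h'
  | smul_left c _ _ _ _ h => rw [smul_lie]; exact Submodule.smul_mem _ c h
  | smul_right c _ _ _ _ h => rw [lie_smul]; exact Submodule.smul_mem _ c h

/-- At a single point function coefficients are just constants, and `S` is a real subspace. -/
theorem exists_mem_apply_eq_of_mem_funSpan {A : SmoothVF E M} (hA : A ∈ funSpan S) (x : M) :
    ∃ B ∈ S, B.1 x = A.1 x := by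
  induction hA using Submodule.span_induction with
  | mem A hA =>
    obtain ⟨f, A, hA, rfl⟩ := hA
    exact ⟨f x • A, S.smul_mem _ hA, rfl⟩
  | zero => exact ⟨0, S.zero_mem, rfl⟩
  | add A A' _ _ h h' =>
    obtain ⟨B, hB, e⟩ := h
    obtain ⟨B', hB', e'⟩ := h'
    refine ⟨B + B', S.add_mem hB hB', ?_⟩
    change B.1 x + B'.1 x = A.1 x + A'.1 x
    rw [e, e']
  | smul c A _ h =>
    obtain ⟨B, hB, e⟩ := h
    refine ⟨c • B, S.smul_mem c hB, ?_⟩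
    change c • B.1 x = c • A.1 x
    rw [e]

/-- The fields whose germ at `x` is the germ of a combination of fields of `S` with smooth
coefficients. -/
noncomputable def germSpan (x : M) (S : Submodule ℝ (SmoothVF E M)) : Submodule ℝ (SmoothVF E M) where
  carrier := {Y | ∃ Z ∈ funSpan S, ∀ᶠ z in 𝓝 x, Y.1 z = Z.1 z}
  add_mem' := by
    rintro Y Y' ⟨Z, hZ, h⟩ ⟨Z', hZ', h'⟩
    refine ⟨Z + Z', Submodule.add_mem _ hZ hZ', ?_⟩
    filter_upwards [h, h'] with z e e'
    exact congrArg₂ (· + ·) e e'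
  zero_mem' := ⟨0, Submodule.zero_mem _, Eventually.of_forall fun _ => rfl⟩
  smul_mem' := by
    rintro c Y ⟨Z, hZ, h⟩
    refine ⟨c • Z, Submodule.smul_mem _ c hZ, ?_⟩
    filter_upwards [h] with z e
    exact congrArg (c • ·) e

theorem germSpan_mono (x : M) (h : S ≤ T) : germSpan x S ≤ germSpan x T :=
  fun _ ⟨Z, hZ, e⟩ => ⟨Z, funSpan_mono h hZ, e⟩

/-- The commutator depends only on germs, so Leibniz expansions may be carried out in local frames,
with no need for global generators. -/
theorem lie_mem_germSpan {x : M} (hS : S ≤ R) (hT : T ≤ R) (hST : ∀ A ∈ S, ∀ B ∈ T, ⁅A, B⁆ ∈ R)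
    {A B : SmoothVF E M} (hA : A ∈ germSpan x S) (hB : B ∈ germSpan x T) :
    ⁅A, B⁆ ∈ germSpan x R := by
  obtain ⟨A', hA', eA⟩ := hA
  obtain ⟨B', hB', eB⟩ := hB
  refine ⟨⁅A', B'⁆, lie_mem_funSpan hS hT hST hA' hB', ?_⟩
  filter_upwards [eventually_eventually_nhds.2 eA, eventually_eventually_nhds.2 eB] with z hz hz'
  exact Filter.EventuallyEq.mlieBracket_vectorField_eq hz hz'

theorem exists_mem_apply_eq_of_mem_germSpan {x : M} {A : SmoothVF E M} (hA : A ∈ germSpan x S) :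
    ∃ B ∈ S, B.1 x = A.1 x := by
  obtain ⟨Z, hZ, e⟩ := hA
  rw [e.self_of_nhds]
  exact exists_mem_apply_eq_of_mem_funSpan hZ x

theorem sum_fsmul_apply {n : ℕ} (f : Fin n → C^∞⟮𝓘(ℝ, E), M; ℝ⟯) (W : Fin n → SmoothVF E M) (z : M) :
    (∑ i, fsmul (f i) (W i)).1 z = ∑ i, f i z • (W i).1 z := by
  rw [Submodule.coe_sum, Finset.sum_apply]
  rfl

theorem mem_germSpan {x : M} {n : ℕ} {W : Fin n → SmoothVF E M} (hW : ∀ i, W i ∈ S)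
    {f : Fin n → C^∞⟮𝓘(ℝ, E), M; ℝ⟯} {Y : SmoothVF E M}
    (h : ∀ᶠ z in 𝓝 x, Y.1 z = ∑ i, f i z • (W i).1 z) : Y ∈ germSpan x S := by
  refine ⟨∑ i, fsmul (f i) (W i), Submodule.sum_mem _ fun i _ => fsmul_mem_funSpan_of_mem _ (hW i), ?_⟩
  filter_upwards [h] with z hz
  rw [hz, sum_fsmul_apply]

/-! ### Local frames -/

/-- The values at `x` of the fields in `S`. -/
noncomputable def valueAt (S : Submodule ℝ (SmoothVF E M)) (x : M) : Submodule ℝ (TangentSpace 𝓘(ℝ, E) x) :=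
  (S.map (SmoothVF E M).subtype).map (LinearMap.proj x)

theorem mem_valueAt {x : M} {v : TangentSpace 𝓘(ℝ, E) x} :
    v ∈ valueAt S x ↔ ∃ X ∈ S, X.1 x = v := by
  constructor
  · rintro ⟨_, ⟨X, hX, rfl⟩, rfl⟩
    exact ⟨X, hX, rfl⟩
  · rintro ⟨X, hX, rfl⟩
    exact ⟨_, ⟨X, hX, rfl⟩, rfl⟩

theorem apply_mem_valueAt {X : SmoothVF E M} (hX : X ∈ S) (x : M) : X.1 x ∈ valueAt S x :=
  mem_valueAt.2 ⟨X, hX, rfl⟩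

/-- A space of vector fields of constant rank has local frames. -/
theorem exists_frame [T2Space M] (S : Submodule ℝ (SmoothVF E M)) (x : M)
    (hS : ∀ z, Module.finrank ℝ (valueAt S z) = Module.finrank ℝ (valueAt S x)) :
    ∃ (n : ℕ) (W : Fin n → SmoothVF E M), (∀ i, W i ∈ S) ∧
      (LinearIndependent ℝ fun i => (W i).1 x) ∧
      (∀ᶠ z in 𝓝 x, Submodule.span ℝ (Set.range fun i => (W i).1 z) = valueAt S z) ∧
      ∀ Y : SmoothVF E M, (∀ z, Y.1 z ∈ valueAt S z) →
        ∃ f : Fin n → C^∞⟮𝓘(ℝ, E), M; ℝ⟯, ∀ᶠ z in 𝓝 x, Y.1 z = ∑ i, f i z • (W i).1 z := by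
  have hfin : ∀ z : M, FiniteDimensional ℝ (TangentSpace 𝓘(ℝ, E) z) := fun _ =>
    inferInstanceAs (FiniteDimensional ℝ E)
  let b := Module.finBasis ℝ (valueAt S x)
  choose W hW hWb using fun i => mem_valueAt.1 (b i).2
  have hli : LinearIndependent ℝ fun i => (W i).1 x := by
    simp only [hWb]
    exact b.linearIndependent.map' (valueAt S x).subtype (Submodule.ker_subtype _)
  have hco := fun Y : SmoothVF E M => exists_smooth_coeff_along (M' := M) (E' := E) (M := M) (E := E) id
    continuous_id (fun i => (W i).1) Y.1 (fun i => (W i).2) Y.2 x hli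
  have hspan : ∀ᶠ z in 𝓝 x, Submodule.span ℝ (Set.range fun i => (W i).1 z) = valueAt S z := by
    -- The field `0` is a dummy: only the independence of the `W i` near `x` is wanted. As many
    -- independent vectors as the constant dimension fill `valueAt S z`.
    obtain ⟨f, hf⟩ := hco 0
    filter_upwards [hf] with z hz
    refine Submodule.eq_of_le_of_finrank_eq (Submodule.span_le.2 ?_) ?_
    · rintro _ ⟨i, rfl⟩
      exact apply_mem_valueAt (hW i) z
    · exact (finrank_span_eq_card hz.1).trans ((Fintype.card_fin _).trans (hS z).symm)
  refine ⟨_, W, hW, hli, hspan, fun Y hY => ?_⟩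
  obtain ⟨f, hf⟩ := hco Y
  refine ⟨f, ?_⟩
  filter_upwards [hf, hspan] with z hz hz'
  exact hz.2 (hz' ▸ hY z)

end SmoothVF

/-! ### Graded homomorphisms and ideals of pure degree. -/

namespace NegGrading

variable {𝔫 𝔪 : Type*} [LieRing 𝔫] [LieAlgebra ℝ 𝔫] [LieRing 𝔪] [LieAlgebra ℝ 𝔪]
  (H : NegGrading 𝔫) (G : NegGrading 𝔪)

theorem map_proj {p : 𝔫 →ₗ[ℝ] 𝔪} (hp : ∀ i, ∀ X ∈ H.piece i, p X ∈ G.piece i) (i : ℕ) (v : 𝔫) :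
    p (H.proj i v) = G.proj i (p v) := by
  induction v using H.piece_induction with
  | zero => simp
  | add a b ha hb => simp only [map_add, ha, hb]
  | mem j v hv =>
    by_cases h : j = i
    · subst h
      rw [H.proj_of_mem hv, G.proj_of_mem (hp j v hv)]
    · rw [H.proj_of_mem_ne h hv, G.proj_of_mem_ne h (hp j v hv), map_zero]

theorem eq_zero_of_mem_piece {i j : ℕ} (hij : i ≠ j) {v : 𝔪} (hi : v ∈ G.piece i)
    (hj : v ∈ G.piece j) : v = 0 := by
  rw [← G.proj_of_mem hj, G.proj_of_mem_ne hij hi]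

/-- An ideal contained in a single component of a negative grading is central. -/
theorem lieIdeal_le_center {I : LieIdeal ℝ 𝔪} {k : ℕ} (hI : ∀ X ∈ I, X ∈ G.piece k) :
    I ≤ LieAlgebra.center ℝ 𝔪 := by
  intro X hX
  rw [LieAlgebra.center, LieModule.mem_maxTrivSubmodule]
  intro Y
  induction Y using G.piece_induction with
  | zero => simp
  | add a b ha hb => rw [add_lie, ha, hb, add_zero]
  | mem i Y hY =>
    rcases i with _ | i
    · rw [G.piece_zero, Submodule.mem_bot] at hY
      simp [hY]
    -- The bracket has degree `-(i + 1 + k)` and, as a member of the ideal, also degree `-k`.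
    · exact G.eq_zero_of_mem_piece (by omega) (G.lie_mem hY (hI X hX))
        (hI _ (lie_mem_right ℝ 𝔪 I Y X hX))

end NegGrading

/-! ### The Carnot algebra of a regular distribution in terms of values at a point. -/

namespace TangentDistribution

open Filter SmoothVF
open scoped Topology

section Values

variable {E : Type*} [NormedAddCommGroup E] [NormedSpace ℝ E] [FiniteDimensional ℝ E]
  {M : Type*} [TopologicalSpace M] [ChartedSpace E M] [IsManifold 𝓘(ℝ, E) ∞ M]
  (Δ : TangentDistribution E M)

theorem mem_flag {i : ℕ} {x : M} {v : TangentSpace 𝓘(ℝ, E) x} :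
    v ∈ Δ.flag i x ↔ ∃ X ∈ Δ.flagSections i, X.1 x = v := mem_valueAt

theorem flag_mono {i j : ℕ} (h : i ≤ j) (x : M) : Δ.flag i x ≤ Δ.flag j x :=
  Submodule.map_mono (Submodule.map_mono (Δ.flagSections_mono h))

theorem valueAt_sections (x : M) : valueAt Δ.sections x = Δ.space x := by
  ext v
  rw [mem_valueAt]
  constructor
  · rintro ⟨X, hX, rfl⟩
    exact hX x
  · exact fun hv => Δ.exists_section x v hv

/-- A section of a term of the derived flag of a regular distribution that vanishes at a point
is a combination of sections with coefficients vanishing at the point. -/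
theorem mem_fiberKer_of_apply_eq_zero [T2Space M] (hΔ : Δ.IsRegular) {x : M} {i : ℕ}
    {Z : SmoothVF E M} (hZ : Z ∈ Δ.flagSections i) (h0 : Z.1 x = 0) : Z ∈ Δ.fiberKer x i := by
  obtain ⟨n, W, hW, hli, -, hco⟩ := exists_frame (Δ.flagSections i) x fun z => hΔ i z x
  obtain ⟨f, hf⟩ := hco Z fun z => apply_mem_valueAt hZ z
  have hfx : ∀ i, f i x = 0 := by
    have h := hf.self_of_nhds
    rw [h0] at h
    exact Fintype.linearIndependent_iff.1 hli (fun i => f i x) h.symm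
  have hgen : ∀ (g : C^∞⟮𝓘(ℝ, E), M; ℝ⟯), g x = 0 → ∀ X ∈ Δ.flagSections i,
      fsmul g X ∈ Δ.fiberKer x i := fun g hg X hX =>
    Submodule.mem_sup_right (Submodule.subset_span ⟨g, hg, X, hX, rfl⟩)
  obtain ⟨h, h1, h2⟩ := exists_smooth_cutoff (E := E) hf
  have hN : ∑ i, fsmul (f i) (W i) ∈ Δ.flagSections i :=
    Submodule.sum_mem _ fun j _ => Δ.fsmul_mem i _ (hW j)
  -- Put `N = ∑ i, f i W i`. Since `Z = N` on the support of `h`, the identity `Z = N + (1 - h)(Z -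
  -- N)` holds on all of `M`, and every coefficient `f i` and `1 - h` vanishes at `x`.
  have e : Z = ∑ i, fsmul (f i) (W i) + fsmul (1 - h) (Z - ∑ i, fsmul (f i) (W i)) := by
    ext z
    change Z.1 z = (∑ i, fsmul (f i) (W i)).1 z +
      (1 - h z) • (Z.1 z - (∑ i, fsmul (f i) (W i)).1 z)
    rw [sum_fsmul_apply]
    by_cases hz : z ∈ tsupport h
    · have hz' := h2 hz
      rw [← show Z.1 z = ∑ i, f i z • (W i).1 z from hz', sub_self, smul_zero, add_zero]
    · rw [image_eq_zero_of_notMem_tsupport hz, sub_zero, one_smul, add_sub_cancel]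
  rw [e]
  refine Submodule.add_mem _ (Submodule.sum_mem _ fun j _ => hgen _ (hfx j) _ (hW j))
    (hgen _ ?_ _ (Submodule.sub_mem _ hZ hN))
  change 1 - h x = 0
  rw [h1.self_of_nhds, Pi.one_apply, sub_self]

theorem apply_mem_flag_of_mem_fiberKer {x : M} {i : ℕ} {X : SmoothVF E M}
    (hX : X ∈ Δ.fiberKer x i) : X.1 x ∈ Δ.flag (i - 1) x := by
  let ev : SmoothVF E M →ₗ[ℝ] TangentSpace 𝓘(ℝ, E) x := LinearMap.proj x ∘ₗ (SmoothVF E M).subtype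
  have h : Δ.fiberKer x i ≤ (Δ.flag (i - 1) x).comap ev := by
    refine sup_le (fun Y hY => Δ.mem_flag.2 ⟨Y, hY, rfl⟩) (Submodule.span_le.2 ?_)
    rintro _ ⟨f, hf, Y, -, rfl⟩
    change f x • Y.1 x ∈ Δ.flag (i - 1) x
    rw [hf, zero_smul]
    exact Submodule.zero_mem _
  exact h hX

/-- Subtracting a section of the previous flag term with the same value at `x` leaves a section that
vanishes at `x`, which regularity puts in `fiberKer`. This is what identifies g_{-i}(x) with
Δ_i(x)/Δ_{i-1}(x). -/
theorem mem_fiberKer_iff [T2Space M] (hΔ : Δ.IsRegular) {x : M} {i : ℕ}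
    {X : SmoothVF E M} (hX : X ∈ Δ.flagSections i) :
    X ∈ Δ.fiberKer x i ↔ X.1 x ∈ Δ.flag (i - 1) x := by
  constructor
  · exact Δ.apply_mem_flag_of_mem_fiberKer
  · intro h
    obtain ⟨Y, hY, e⟩ := Δ.mem_flag.1 h
    have h1 : X - Y ∈ Δ.fiberKer x i := by
      refine Δ.mem_fiberKer_of_apply_eq_zero hΔ
        (Submodule.sub_mem _ hX (Δ.flagSections_mono (Nat.sub_le i 1) hY)) ?_
      change X.1 x - Y.1 x = 0
      rw [e, sub_self]
    have h2 := Submodule.add_mem _ h1 (Submodule.mem_sup_left hY : Y ∈ Δ.fiberKer x i)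
    rwa [sub_add_cancel] at h2

theorem cls_eq_zero_iff [T2Space M] (hΔ : Δ.IsRegular) {x : M} {i : ℕ} {X : Δ.flagSections i} :
    Δ.cls x i X = 0 ↔ X.1.1 x ∈ Δ.flag (i - 1) x := by
  rw [← Δ.mem_fiberKer_iff hΔ X.2]
  refine ⟨fun h => ?_, Δ.cls_eq_zero x⟩
  have h1 := Δ.carnotComponent_cls x i X
  rw [h, map_zero] at h1
  exact (Submodule.Quotient.mk_eq_zero ((Δ.fiberKer x i).submoduleOf (Δ.flagSections i))).1 h1.symm

theorem cls_eq_cls_iff [T2Space M] (hΔ : Δ.IsRegular) {x : M} {i : ℕ} {X Y : Δ.flagSections i} :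
    Δ.cls x i X = Δ.cls x i Y ↔ X.1.1 x - Y.1.1 x ∈ Δ.flag (i - 1) x := by
  rw [← sub_eq_zero, ← map_sub, Δ.cls_eq_zero_iff hΔ]
  rfl

/-- For a regular distribution, the class of a section depends only on its value. -/
theorem exists_valueCls [T2Space M] (hΔ : Δ.IsRegular) (x : M) (i : ℕ) :
    ∃ φ : Δ.flag i x →ₗ[ℝ] Δ.Carnot x, ∀ (X : Δ.flagSections i) (v : Δ.flag i x),
      X.1.1 x = v.1 → φ v = Δ.cls x i X := by
  let ev : Δ.flagSections i →ₗ[ℝ] Δ.flag i x :=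
    { toFun := fun X => ⟨X.1.1 x, Δ.mem_flag.2 ⟨X.1, X.2, rfl⟩⟩
      map_add' := fun _ _ => rfl
      map_smul' := fun _ _ => rfl }
  have hev : Function.Surjective ev := by
    rintro ⟨v, hv⟩
    obtain ⟨X, hX, e⟩ := Δ.mem_flag.1 hv
    exact ⟨⟨X, hX⟩, Subtype.ext e⟩
  -- A linear choice of a section through each value; by `cls_eq_cls_iff` the class does not depend
  -- on it.
  obtain ⟨s, hs⟩ := ev.exists_rightInverse_of_surjective (LinearMap.range_eq_top.2 hev)
  refine ⟨Δ.cls x i ∘ₗ s, fun X v h => (Δ.cls_eq_cls_iff hΔ).2 ?_⟩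
  have h1 : (s v).1.1 x = v.1 := congrArg Subtype.val (LinearMap.congr_fun hs v)
  rw [h1, h, sub_self]
  exact Submodule.zero_mem _

/-- The universal property of the Carnot algebra as a vector space. -/
theorem exists_carnot_lift (x : M) {V : Type*} [AddCommGroup V] [Module ℝ V]
    (ψ : ∀ i, Δ.flagSections i →ₗ[ℝ] V)
    (hψ : ∀ i, ∀ X : Δ.flagSections i, X.1 ∈ Δ.fiberKer x i → ψ i X = 0) :
    ∃ p : Δ.Carnot x →ₗ[ℝ] V, ∀ i X, p (Δ.cls x i X) = ψ i X := by
  refine ⟨DirectSum.toModule ℝ ℕ V fun i =>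
    Submodule.liftQ ((Δ.fiberKer x i).submoduleOf (Δ.flagSections i)) (ψ i) (hψ i), fun i X => ?_⟩
  exact DirectSum.toModule_lof ℝ i (Δ.pieceMk x i X)

end Values

end TangentDistribution

/-! ### Integrable extensions: lifting, projectable generators, the map of Carnot algebras. -/

namespace IsIntegrableExtension

open Filter SmoothVF
open scoped Topology

variable {E' : Type*} [NormedAddCommGroup E'] [NormedSpace ℝ E'] [FiniteDimensional ℝ E']
  {M' : Type*} [TopologicalSpace M'] [ChartedSpace E' M'] [IsManifold 𝓘(ℝ, E') ∞ M'] [T2Space M']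
  {E : Type*} [NormedAddCommGroup E] [NormedSpace ℝ E] [FiniteDimensional ℝ E]
  {M : Type*} [TopologicalSpace M] [ChartedSpace E M] [IsManifold 𝓘(ℝ, E) ∞ M] [T2Space M]
  {π : M' → M} {Δ' : TangentDistribution E' M'} {Δ : TangentDistribution E M}

/-- Sections of `Δ` lift to sections of `Δ'`. -/
theorem exists_lift_sections (hπ : IsIntegrableExtension Δ' Δ π) {X : SmoothVF E M}
    (hX : X ∈ Δ.sections) : ∃ X' ∈ Δ'.sections, IsRelated π X' X := by
  -- The lift is already determined pointwise; only its smoothness is at stake.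
  choose Y hY hYX using fun y => (hπ.bijOn y).surjOn (hX (π y))
  suffices h : ContMDiff 𝓘(ℝ, E') 𝓘(ℝ, E').tangent ∞
      (fun y => (⟨y, Y y⟩ : TangentBundle 𝓘(ℝ, E') M')) from ⟨⟨Y, h⟩, hY, hYX⟩
  intro y
  obtain ⟨n, W, hW, hli, hspan, -⟩ := exists_frame Δ'.sections y fun z => by
    rw [Δ'.valueAt_sections, Δ'.valueAt_sections]; exact Δ'.finrank_eq z y
  let D := fun z => mfderiv 𝓘(ℝ, E') 𝓘(ℝ, E) π z
  have hT : ContMDiff 𝓘(ℝ, E').tangent 𝓘(ℝ, E).tangent ∞ (tangentMap 𝓘(ℝ, E') 𝓘(ℝ, E) π) :=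
    hπ.contMDiff.contMDiff_tangentMap (by simp)
  -- A local frame of `Δ'` is pushed to independent fields along `π`. The coefficients of `X ∘ π`
  -- with respect to them are smooth, and the same coefficients express `Y` in the frame.
  have hli' : LinearIndependent ℝ fun i => D y ((W i).1 y) := by
    rw [Fintype.linearIndependent_iff]
    intro c hc
    refine Fintype.linearIndependent_iff.1 hli c ((hπ.bijOn y).injOn ?_ (Δ'.space y).zero_mem ?_)
    · exact Submodule.sum_mem _ fun i _ => Submodule.smul_mem _ _ (hW i y)
    · rw [map_zero, map_sum, ← hc]
      exact Finset.sum_congr rfl fun i _ => map_smul _ _ _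
  obtain ⟨f, hf⟩ := exists_smooth_coeff_along π hπ.contMDiff.continuous
    (fun i z => D z ((W i).1 z)) (fun z => X.1 (π z)) (fun i => hT.comp (W i).2)
    (X.2.comp hπ.contMDiff) y hli'
  refine (SmoothVF.contMDiff (∑ i, fsmul (f i) (W i)) y).congr_of_eventuallyEq ?_
  filter_upwards [hf, hspan] with z hz hz'
  have h1 : Y z ∈ Submodule.span ℝ (Set.range fun i => (W i).1 z) := by
    rw [hz', Δ'.valueAt_sections]; exact hY z
  have h2 : X.1 (π z) ∈ Submodule.span ℝ (Set.range fun i => D z ((W i).1 z)) := by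
    have := Submodule.mem_map_of_mem (f := (D z).toLinearMap) h1
    rw [Submodule.map_span, ← Set.range_comp] at this
    rw [← hYX z]
    exact this
  have h3 : Y z = (∑ i, fsmul (f i) (W i)).1 z := by
    refine (hπ.bijOn z).injOn (hY z) ?_ ?_
    · rw [sum_fsmul_apply]
      exact Submodule.sum_mem _ fun i _ => Submodule.smul_mem _ _ (hW i z)
    · rw [hYX, hz.2 h2, sum_fsmul_apply, map_sum]
      exact Finset.sum_congr rfl fun i _ => (map_smul _ _ _).symm
  rw [h3]

/-- The recursive construction of Γ(Δ_i) is copied upstairs: a bracket lifts to the bracket of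
lifts, since commutators of related fields are related. -/
theorem exists_lift (hπ : IsIntegrableExtension Δ' Δ π) {i : ℕ} {X : SmoothVF E M}
    (hX : X ∈ Δ.flagSections i) : ∃ X' ∈ Δ'.flagSections i, IsRelated π X' X := by
  induction i generalizing X with
  | zero =>
    obtain rfl : X = 0 := by simpa [TangentDistribution.flagSections] using hX
    exact ⟨0, Submodule.zero_mem _, isRelated_zero π⟩
  | succ i ih =>
  rcases i with _ | i
  · exact hπ.exists_lift_sections hX
  · obtain ⟨A, hA, B, hB, rfl⟩ := Submodule.mem_sup.1 hX
    suffices h : ∃ B' ∈ Δ'.flagSections (i + 2), IsRelated π B' B by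
      obtain ⟨B', hB', hB⟩ := h
      obtain ⟨A', hA', hA⟩ := ih hA
      exact ⟨A' + B', Submodule.add_mem _ (Δ'.flagSections_le_succ _ hA') hB', hA.add hB⟩
    clear hX
    induction hB using Submodule.span_induction with
    | mem B hB =>
      obtain ⟨Y, hY, Z, hZ, rfl⟩ := hB
      obtain ⟨Y', hY', hY⟩ := hπ.exists_lift_sections hY
      obtain ⟨Z', hZ', hZ⟩ := ih hZ
      exact ⟨⁅Y', Z'⁆, Δ'.lie_sections_mem hY' hZ', hY.lie hπ.contMDiff hZ⟩
    | zero => exact ⟨0, Submodule.zero_mem _, isRelated_zero π⟩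
    | add B C _ _ hB hC =>
      obtain ⟨B', hB', hB⟩ := hB
      obtain ⟨C', hC', hC⟩ := hC
      exact ⟨B' + C', Submodule.add_mem _ hB' hC', hB.add hC⟩
    | smul c B _ hB =>
      obtain ⟨B', hB', hB⟩ := hB
      exact ⟨c • B', Submodule.smul_mem _ c hB', hB.smul c⟩

/-- The sections of `Δ'_i` that are related to sections of `Δ_i`. -/
noncomputable def _root_.TangentDistribution.relatedSections (Δ' : TangentDistribution E' M')
    (Δ : TangentDistribution E M) (π : M' → M) (i : ℕ) : Submodule ℝ (SmoothVF E' M') where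
  carrier := {X' | X' ∈ Δ'.flagSections i ∧ ∃ X ∈ Δ.flagSections i, IsRelated π X' X}
  add_mem' := fun ⟨h1, X, hX, h⟩ ⟨h1', Y, hY, h'⟩ =>
    ⟨Submodule.add_mem _ h1 h1', X + Y, Submodule.add_mem _ hX hY, h.add h'⟩
  zero_mem' := ⟨Submodule.zero_mem _, 0, Submodule.zero_mem _, isRelated_zero π⟩
  smul_mem' := fun c _ ⟨h1, X, hX, h⟩ =>
    ⟨Submodule.smul_mem _ c h1, c • X, Submodule.smul_mem _ c hX, h.smul c⟩

theorem relatedSections_mono {i j : ℕ} (h : i ≤ j) :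
    Δ'.relatedSections Δ π i ≤ Δ'.relatedSections Δ π j := fun _ ⟨h1, X, hX, h2⟩ =>
  ⟨Δ'.flagSections_mono h h1, X, Δ.flagSections_mono h hX, h2⟩

theorem valueAt_relatedSections_one (hπ : IsIntegrableExtension Δ' Δ π) (x : M') :
    valueAt (Δ'.relatedSections Δ π 1) x = Δ'.space x := by
  ext v
  rw [mem_valueAt]
  constructor
  · rintro ⟨X, hX, rfl⟩
    exact hX.1 x
  · intro hv
    obtain ⟨X, hX, e⟩ := Δ.exists_section (π x) _ ((hπ.bijOn x).mapsTo hv)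
    obtain ⟨X', hX', h⟩ := hπ.exists_lift_sections hX
    exact ⟨X', ⟨hX', X, hX, h⟩, (hπ.bijOn x).injOn (hX' x) hv ((h x).trans e)⟩

/-- Sections of `Δ'_i` are locally combinations of sections related to sections of `Δ_i`. -/
theorem flagSections_le_germSpan (hπ : IsIntegrableExtension Δ' Δ π) (x : M') (i : ℕ) :
    Δ'.flagSections i ≤ germSpan x (Δ'.relatedSections Δ π i) := by
  induction i with
  | zero => exact bot_le
  | succ i ih =>
  -- Lifts of sections of `Δ` take all values in `Δ'`, so constant rank provides local frames made
  -- of lifts.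
  have h1 : Δ'.sections ≤ germSpan x (Δ'.relatedSections Δ π 1) := by
    obtain ⟨n, W, hW, -, -, hco⟩ := exists_frame (Δ'.relatedSections Δ π 1) x fun z => by
      rw [hπ.valueAt_relatedSections_one, hπ.valueAt_relatedSections_one]
      exact Δ'.finrank_eq z x
    intro Y hY
    obtain ⟨f, hf⟩ := hco Y fun z => by rw [hπ.valueAt_relatedSections_one]; exact hY z
    exact mem_germSpan hW hf
  rcases i with _ | i
  · exact h1
  · refine sup_le (ih.trans (germSpan_mono x (relatedSections_mono (by omega))))
      (Submodule.span_le.2 ?_)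
    rintro _ ⟨A, hA, B, hB, rfl⟩
    -- It suffices to bracket projectable generators, and their brackets are again projectable.
    refine lie_mem_germSpan (relatedSections_mono (by omega)) (relatedSections_mono (by omega))
      ?_ (h1 hA) (ih hB)
    rintro A ⟨hA, X, hX, hAX⟩ B ⟨hB, Y, hY, hBY⟩
    exact ⟨Δ'.lie_sections_mem hA hB, ⁅X, Y⁆, Δ.lie_sections_mem hX hY, hAX.lie hπ.contMDiff hBY⟩

/-- Freezing the function coefficients at `x` turns a local combination of projectable fields into
one projectable field with the same value. -/
theorem exists_related_apply_eq (hπ : IsIntegrableExtension Δ' Δ π) (x : M') {i : ℕ}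
    {X' : SmoothVF E' M'} (hX' : X' ∈ Δ'.flagSections i) :
    ∃ B ∈ Δ'.flagSections i, B.1 x = X'.1 x ∧ ∃ X ∈ Δ.flagSections i, IsRelated π B X := by
  obtain ⟨B, hB, e⟩ := exists_mem_apply_eq_of_mem_germSpan (hπ.flagSections_le_germSpan x i hX')
  exact ⟨B, hB.1, e, hB.2⟩

/-- Projectable representatives give one inclusion, lifts the other. -/
theorem map_flag (hπ : IsIntegrableExtension Δ' Δ π) (x : M') (i : ℕ) :
    (Δ'.flag i x).map (mfderiv 𝓘(ℝ, E') 𝓘(ℝ, E) π x).toLinearMap = Δ.flag i (π x) := by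
  ext v
  constructor
  · rintro ⟨w, hw, rfl⟩
    obtain ⟨X', hX', rfl⟩ := Δ'.mem_flag.1 hw
    obtain ⟨B, hB, e, X, hX, h⟩ := hπ.exists_related_apply_eq x hX'
    exact Δ.mem_flag.2 ⟨X, hX, by rw [← e]; exact (h x).symm⟩
  · intro hv
    obtain ⟨X, hX, rfl⟩ := Δ.mem_flag.1 hv
    obtain ⟨X', hX', h⟩ := hπ.exists_lift hX
    exact ⟨_, Δ'.mem_flag.2 ⟨X', hX', rfl⟩, h x⟩

/-- An integrable extension of regular distributions induces homomorphisms of Carnot algebras. -/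
theorem exists_carnotMap (hπ : IsIntegrableExtension Δ' Δ π) (hΔ : Δ.IsRegular)
    (hΔ' : Δ'.IsRegular) (x : M') : ∃ p : Δ'.Carnot x →ₗ⁅ℝ⁆ Δ.Carnot (π x),
      ∀ (i : ℕ) (X' : Δ'.flagSections i) (X : Δ.flagSections i),
        mfderiv 𝓘(ℝ, E') 𝓘(ℝ, E) π x (X'.1.1 x) = X.1.1 (π x) →
          p (Δ'.cls x i X') = Δ.cls (π x) i X := by
  let D := mfderiv 𝓘(ℝ, E') 𝓘(ℝ, E) π x
  choose φ hφ using Δ.exists_valueCls hΔ (π x)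
  have hD : ∀ {i : ℕ} (X' : Δ'.flagSections i), D (X'.1.1 x) ∈ Δ.flag i (π x) := fun {i} X' => by
    rw [← hπ.map_flag x i]
    exact Submodule.mem_map_of_mem (Δ'.mem_flag.2 ⟨X'.1, X'.2, rfl⟩)
  let ψ : ∀ i, Δ'.flagSections i →ₗ[ℝ] Δ.Carnot (π x) := fun i => φ i ∘ₗ
    { toFun := fun X' => ⟨D (X'.1.1 x), hD X'⟩
      map_add' := fun X Y => Subtype.ext (map_add D (X.1.1 x) (Y.1.1 x))
      map_smul' := fun c X => Subtype.ext (map_smul D c (X.1.1 x)) }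
  have hψ : ∀ (i : ℕ) (X' : Δ'.flagSections i) (X : Δ.flagSections i),
      D (X'.1.1 x) = X.1.1 (π x) → ψ i X' = Δ.cls (π x) i X := fun i X' X h => hφ i X _ h.symm
  -- Well defined because `D` maps Δ'_{i-1}(x) into Δ_{i-1}(π x).
  obtain ⟨p, hp⟩ := Δ'.exists_carnot_lift x ψ (by
    intro i X' hX'
    have h1 := Δ'.apply_mem_flag_of_mem_fiberKer hX'
    have h2 : D (X'.1.1 x) ∈ Δ.flag (i - 1) (π x) := by
      rw [← hπ.map_flag x]
      exact Submodule.mem_map_of_mem h1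
    obtain ⟨X, hX, e⟩ := Δ.mem_flag.1 (hD X')
    rw [hψ i X' ⟨X, hX⟩ e.symm, Δ.cls_eq_zero_iff hΔ]
    exact e ▸ h2)
  have hpr : ∀ (i : ℕ) (X' : Δ'.flagSections i) (X : Δ.flagSections i),
      D (X'.1.1 x) = X.1.1 (π x) → p (Δ'.cls x i X') = Δ.cls (π x) i X := fun i X' X h =>
    (hp i X').trans (hψ i X' X h)
  -- Values at `x` do not determine values of commutators, so brackets are compared on
  -- representatives that project globally.
  have hrel : ∀ (i : ℕ) (X' : Δ'.flagSections i), ∃ B : Δ'.flagSections i,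
      Δ'.cls x i X' = Δ'.cls x i B ∧ ∃ X : Δ.flagSections i, IsRelated π B.1 X.1 := by
    intro i X'
    obtain ⟨B, hB, e, X, hX, h⟩ := hπ.exists_related_apply_eq x X'.2
    refine ⟨⟨B, hB⟩, (Δ'.cls_eq_cls_iff hΔ').2 ?_, ⟨X, hX⟩, h⟩
    rw [e, sub_self]
    exact Submodule.zero_mem _
  refine ⟨{ p with map_lie' := fun {a b} => ?_ }, hpr⟩
  change p ⁅a, b⁆ = ⁅p a, p b⁆
  induction a using Δ'.carnot_induction x with
  | zero => simp
  | add a a' h h' => simp only [add_lie, map_add, h, h']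
  | cls i X' =>
  induction b using Δ'.carnot_induction x with
  | zero => simp
  | add b b' h h' => simp only [lie_add, map_add, h, h']
  | cls j Y' =>
  obtain ⟨A, eA, X, hX⟩ := hrel i X'
  obtain ⟨B, eB, Y, hY⟩ := hrel j Y'
  rw [eA, eB, hpr i A X (hX x), hpr j B Y (hY x), Δ'.lie_cls, Δ.lie_cls]
  exact hpr _ _ _ (hX.lie hπ.contMDiff hY x)

/-- An integrable extension of regular distributions, with fibre of pure grading `-k`, induces a
central extension of Carnot algebras. -/
theorem exists_isCentralExtension (hπ : IsIntegrableExtension Δ' Δ π) (hΔ : Δ.IsRegular)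
    (hΔ' : Δ'.IsRegular) (x : M') {d k : ℕ}
    (hd : Module.finrank ℝ (LinearMap.ker (mfderiv 𝓘(ℝ, E') 𝓘(ℝ, E) π x).toLinearMap) = d)
    (hle : LinearMap.ker (mfderiv 𝓘(ℝ, E') 𝓘(ℝ, E) π x).toLinearMap ≤ Δ'.flag k x)
    (hdis : Disjoint (LinearMap.ker (mfderiv 𝓘(ℝ, E') 𝓘(ℝ, E) π x).toLinearMap)
      (Δ'.flag (k - 1) x)) :
    ∃ p : Δ'.Carnot x →ₗ⁅ℝ⁆ Δ.Carnot (π x),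
      IsCentralExtension (Δ'.carnotGrading x) (Δ.carnotGrading (π x)) d k p ∧
      ∀ (i : ℕ) (X' : Δ'.flagSections i) (X : Δ.flagSections i),
        mfderiv 𝓘(ℝ, E') 𝓘(ℝ, E) π x (X'.1.1 x) = X.1.1 (π x) →
          p (Δ'.cls x i X') = Δ.cls (π x) i X := by
  obtain ⟨p, hp⟩ := hπ.exists_carnotMap hΔ hΔ' x
  set D := (mfderiv 𝓘(ℝ, E') 𝓘(ℝ, E) π x).toLinearMap with hDdef
  have hrel : ∀ (i : ℕ) (X' : Δ'.flagSections i), ∃ X : Δ.flagSections i,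
      D (X'.1.1 x) = X.1.1 (π x) := by
    intro i X'
    have h : D (X'.1.1 x) ∈ Δ.flag i (π x) := by
      rw [← hπ.map_flag x i]
      exact Submodule.mem_map_of_mem (Δ'.mem_flag.2 ⟨X'.1, X'.2, rfl⟩)
    obtain ⟨X, hX, e⟩ := Δ.mem_flag.1 h
    exact ⟨⟨X, hX⟩, e.symm⟩
  have hmap : ∀ i, ∀ a ∈ (Δ'.carnotGrading x).piece i, p a ∈ (Δ.carnotGrading (π x)).piece i := by
    rintro i _ ⟨X', rfl⟩
    obtain ⟨X, h⟩ := hrel i X'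
    exact ⟨X, (hp i X' X h).symm⟩
  -- The image under `D` of the value lies in Δ_{i-1}(π x), which is the image of Δ'_{i-1}(x);
  -- subtracting a preimage leaves a vertical vector.
  have hker : ∀ i (X' : Δ'.flagSections i), p (Δ'.cls x i X') = 0 →
      ∃ u ∈ Δ'.flag (i - 1) x, X'.1.1 x - u ∈ LinearMap.ker D := by
    intro i X' h
    obtain ⟨X, hX⟩ := hrel i X'
    rw [hp i X' X hX, Δ.cls_eq_zero_iff hΔ, ← hX, ← hπ.map_flag x] at h
    obtain ⟨u, hu, e⟩ := h
    refine ⟨u, hu, ?_⟩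
    rw [LinearMap.mem_ker, map_sub, sub_eq_zero]
    exact e.symm
  have hmem : ∀ {i : ℕ} (X' : Δ'.flagSections i), X'.1.1 x ∈ Δ'.flag i x := fun X' =>
    Δ'.mem_flag.2 ⟨X'.1, X'.2, rfl⟩
  -- For `i < k` the vertical part lies in Δ'_{k-1}(x), so it is zero; for `i > k` it lies in
  -- Δ'_k(x), hence in Δ'_{i-1}(x), and is invisible in the quotient.
  have hne : ∀ i, i ≠ k → ∀ X' : Δ'.flagSections i, p (Δ'.cls x i X') = 0 →
      Δ'.cls x i X' = 0 := by
    intro i hi X' h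
    obtain ⟨u, hu, hv⟩ := hker i X' h
    rw [Δ'.cls_eq_zero_iff hΔ']
    rcases lt_or_gt_of_ne hi with hi | hi
    · have h1 : X'.1.1 x - u ∈ Δ'.flag (k - 1) x :=
        Δ'.flag_mono (by omega) x (Submodule.sub_mem _ (hmem X') (Δ'.flag_mono (Nat.sub_le i 1) x hu))
      rw [sub_eq_zero.1 (Submodule.disjoint_def.1 hdis _ hv h1)]
      exact hu
    · have h1 := Submodule.add_mem _ (Δ'.flag_mono (show k ≤ i - 1 by omega) x (hle hv)) hu
      rwa [sub_add_cancel] at h1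
  have hpiece : ∀ a ∈ p.ker, a ∈ (Δ'.carnotGrading x).piece k := by
    intro a ha
    set H := Δ'.carnotGrading x with hH
    have ha' : p a = 0 := (LieHom.mem_ker (f := p)).1 ha
    have h0 : a - H.proj k a = 0 := by
      -- Since `p` commutes with the projections it kills each component of `a`, and `hne` then
      -- removes those outside degree `-k`.
      refine H.eq_zero_of_proj fun i => ?_
      rw [map_sub]
      by_cases hi : i = k
      · subst hi
        rw [H.proj_of_mem (H.proj_mem i a), sub_self]
      · rw [H.proj_of_mem_ne (Ne.symm hi) (H.proj_mem k a), sub_zero]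
        obtain ⟨X', hX'⟩ := H.proj_mem i a
        rw [← hX']
        refine hne i hi X' ?_
        rw [hX']
        refine (NegGrading.map_proj H (Δ.carnotGrading (π x)) (p := (p : _ →ₗ[ℝ] _)) hmap i a).trans ?_
        refine (congrArg _ ha').trans (map_zero _)
    rw [sub_eq_zero.1 h0]
    exact H.proj_mem k a
  refine ⟨p, ⟨?_, hmap, NegGrading.lieIdeal_le_center _ hpiece, ?_, hpiece⟩, hp⟩
  · intro b
    induction b using Δ.carnot_induction (π x) with
    | zero => exact ⟨0, map_zero p⟩
    | add b b' h h' =>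
      obtain ⟨a, rfl⟩ := h
      obtain ⟨a', rfl⟩ := h'
      exact ⟨a + a', map_add p a a'⟩
    | cls i X =>
      obtain ⟨X', hX', h⟩ := hπ.exists_lift X.2
      exact ⟨Δ'.cls x i ⟨X', hX'⟩, hp i _ X (h x)⟩
  · obtain ⟨φ, hφ⟩ := Δ'.exists_valueCls hΔ' x k
    have hzero : ∀ X' : Δ'.flagSections k, D (X'.1.1 x) = 0 → p (Δ'.cls x k X') = 0 :=
      fun X' h => (hp k X' 0 h).trans (map_zero _)
    -- A vertical vector is sent to its class in degree `-k`. Injectivity is the disjointness from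
    -- Δ'_{k-1}(x), surjectivity onto the kernel is `hker`.
    let j : LinearMap.ker D →ₗ[ℝ] Δ'.Carnot x := φ ∘ₗ Submodule.inclusion hle
    have hj : ∀ w : LinearMap.ker D, ∃ X' : Δ'.flagSections k,
        X'.1.1 x = w.1 ∧ j w = Δ'.cls x k X' := by
      intro w
      obtain ⟨X', hX', e⟩ := Δ'.mem_flag.1 (hle w.2)
      exact ⟨⟨X', hX'⟩, e, hφ ⟨X', hX'⟩ _ e⟩
    have hjker : ∀ w, j w ∈ p.ker := by
      intro w
      obtain ⟨X', e, h⟩ := hj w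
      rw [h, LieHom.mem_ker]
      exact hzero X' (e ▸ w.2)
    let J : LinearMap.ker D →ₗ[ℝ] p.ker := j.codRestrict p.ker.toSubmodule hjker
    have hJ : Function.Bijective J := by
      constructor
      · refine (injective_iff_map_eq_zero J).2 fun w hw => ?_
        have hw' : j w = 0 := congrArg Subtype.val hw
        obtain ⟨X', e, h⟩ := hj w
        rw [h, Δ'.cls_eq_zero_iff hΔ', e] at hw'
        exact Subtype.ext (Submodule.disjoint_def.1 hdis _ w.2 hw')
      · rintro ⟨a, ha⟩
        obtain ⟨X', rfl⟩ := hpiece a ha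
        obtain ⟨u, hu, hv⟩ := hker k X' ((LieHom.mem_ker (f := p)).1 ha)
        refine ⟨⟨_, hv⟩, Subtype.ext ?_⟩
        change j ⟨_, hv⟩ = Δ'.cls x k X'
        obtain ⟨Y', e, h⟩ := hj ⟨_, hv⟩
        rw [h, Δ'.cls_eq_cls_iff hΔ', e]
        simpa using hu
    have hfin : FiniteDimensional ℝ (TangentSpace 𝓘(ℝ, E') x) :=
      inferInstanceAs (FiniteDimensional ℝ E')
    let e := LinearEquiv.ofBijective J hJ
    have : Module.Finite ℝ p.ker := Module.Finite.equiv e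
    rw [← Module.finrank_eq_rank, ← e.finrank_eq, hd]

end IsIntegrableExtension

/-! ### Flat models: commutators of left-invariant fields and the derived flag. -/

namespace NegGrading

open SmoothVF

section FlatModel

variable {𝔪 : Type*} [LieRing 𝔪] [LieAlgebra ℝ 𝔪] [FiniteDimensional ℝ 𝔪] (G : NegGrading 𝔪)

instance : T2Space G.FlatModel := inferInstanceAs (T2Space G.Space)

/-- The left invariant vector fields as a linear map. -/
noncomputable def leftInvariantₗ : 𝔪 →ₗ[ℝ] SmoothVF G.Space G.FlatModel where
  toFun := G.leftInvariantField
  map_add' X Y := by ext u; exact map_add (G.leftInvariant u) X Y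
  map_smul' c X := by ext u; exact map_smul (G.leftInvariant u) c X

theorem leftInvariantₗ_lie (X Y : 𝔪) :
    G.leftInvariantₗ ⁅X, Y⁆ = ⁅G.leftInvariantₗ X, G.leftInvariantₗ Y⁆ := by
  ext u
  have h := congrFun (mulInvariantVector_mlieBracket (I := 𝓘(ℝ, G.Space)) (G := G.FlatModel)
    (G.lieEquiv X) (G.lieEquiv Y)) u
  have h1 : G.lieEquiv ⁅X, Y⁆ = ⁅G.lieEquiv X, G.lieEquiv Y⁆ :=
    G.lieEquiv.map_lie X Y
  rw [GroupLieAlgebra.bracket_def] at h1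
  rw [← h1] at h
  exact h

theorem leftInvariant_bijective (u : G.FlatModel) : Function.Bijective (G.leftInvariant u) := by
  have : FiniteDimensional ℝ (TangentSpace 𝓘(ℝ, G.Space) u) :=
    inferInstanceAs (FiniteDimensional ℝ G.Space)
  refine ⟨G.leftInvariant_injective u, (LinearMap.injective_iff_surjective_of_finrank_eq_finrank
    ?_).1 (G.leftInvariant_injective u)⟩
  rfl

theorem valueAt_map_leftInvariantₗ (S : Submodule ℝ 𝔪) (u : G.FlatModel) :
    valueAt (S.map G.leftInvariantₗ) u = S.map (G.leftInvariant u) := by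
  ext v
  rw [mem_valueAt]
  constructor
  · rintro ⟨_, ⟨X, hX, rfl⟩, rfl⟩
    exact ⟨X, hX, rfl⟩
  · rintro ⟨X, hX, rfl⟩
    exact ⟨_, ⟨X, hX, rfl⟩, rfl⟩

/-- Arbitrary sections reduce locally to left-invariant fields with function coefficients, so that
the derived flag can be bounded by brackets in the Lie algebra. -/
theorem flatDistribution_sections_le (u : G.FlatModel) :
    G.flatDistribution.sections ≤ germSpan u ((G.piece 1).map G.leftInvariantₗ) := by
  have hv : ∀ z, valueAt ((G.piece 1).map G.leftInvariantₗ) z = G.flatDistribution.space z :=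
    G.valueAt_map_leftInvariantₗ (G.piece 1)
  obtain ⟨n, W, hW, -, -, hco⟩ := exists_frame ((G.piece 1).map G.leftInvariantₗ) u fun z => by
    rw [hv, hv]
    exact G.flatDistribution.finrank_eq z u
  intro Y hY
  obtain ⟨f, hf⟩ := hco Y fun z => by rw [hv]; exact hY z
  exact mem_germSpan hW hf

/-- The derived distribution of the flat model is contained in `g_{-1} ⊕ g_{-2}`. -/
theorem flatDistribution_flag_two_le (u : G.FlatModel) :
    G.flatDistribution.flag 2 u ≤ (G.piece 1 ⊔ G.piece 2).map (G.leftInvariant u) := by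
  set R := (G.piece 1 ⊔ G.piece 2).map G.leftInvariantₗ with hR
  have h1 : (G.piece 1).map G.leftInvariantₗ ≤ R := Submodule.map_mono le_sup_left
  have h2 : G.flatDistribution.flagSections 2 ≤ germSpan u R := by
    refine sup_le ((G.flatDistribution_sections_le u).trans (germSpan_mono u h1))
      (Submodule.span_le.2 ?_)
    rintro _ ⟨A, hA, B, hB, rfl⟩
    refine lie_mem_germSpan h1 h1 ?_ (G.flatDistribution_sections_le u hA)
      (G.flatDistribution_sections_le u hB)
    rintro _ ⟨X, hX, rfl⟩ _ ⟨Y, hY, rfl⟩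
    exact ⟨⁅X, Y⁆, Submodule.mem_sup_right (G.lie_mem hX hY), G.leftInvariantₗ_lie X Y⟩
  intro v hv
  obtain ⟨X, hX, rfl⟩ := G.flatDistribution.mem_flag.1 hv
  rw [← valueAt_map_leftInvariantₗ, mem_valueAt]
  exact exists_mem_apply_eq_of_mem_germSpan (h2 hX)

/-- The flat model of a fundamental graded nilpotent Lie algebra is completely non-holonomic. -/
theorem IsFundamental.isCompletelyNonholonomic (hG : G.IsFundamental) :
    G.flatDistribution.IsCompletelyNonholonomic := by
  -- The elements whose left-invariant field lies in Γ(Δ_n). The union over `n` is a subalgebra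
  -- containing g_{-1}, hence everything, and finite dimension makes a single `n` suffice.
  let K : ℕ →o Submodule ℝ 𝔪 :=
    ⟨fun n => (G.flatDistribution.flagSections n).comap G.leftInvariantₗ, fun i j h =>
      Submodule.comap_mono (G.flatDistribution.flagSections_mono h)⟩
  let L : LieSubalgebra ℝ 𝔪 :=
    { carrier := {X | ∃ n, X ∈ K n}
      add_mem' := fun {X Y} ⟨i, hi⟩ ⟨j, hj⟩ => ⟨max i j, Submodule.add_mem _
        (K.monotone (le_max_left i j) hi) (K.monotone (le_max_right i j) hj)⟩
      zero_mem' := ⟨0, Submodule.zero_mem _⟩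
      smul_mem' := fun c X ⟨i, hi⟩ => ⟨i, Submodule.smul_mem _ c hi⟩
      lie_mem' := fun {X Y} ⟨i, hi⟩ ⟨j, hj⟩ => ⟨i + j, by
        change G.leftInvariantₗ ⁅X, Y⁆ ∈ G.flatDistribution.flagSections (i + j)
        rw [leftInvariantₗ_lie]
        exact G.flatDistribution.lie_mem (i := i) (j := j) hi hj⟩ }
  have hL : ∀ X, X ∈ L := by
    have h1 : LieSubalgebra.lieSpan ℝ 𝔪 (G.piece 1) ≤ L :=
      LieSubalgebra.lieSpan_le.2 fun X hX => ⟨1, fun u => ⟨X, hX, rfl⟩⟩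
    rw [hG] at h1
    exact fun X => h1 trivial
  obtain ⟨n, hn⟩ := monotone_stabilizes_iff_noetherian.2 (inferInstance : IsNoetherian ℝ 𝔪) K
  refine ⟨n, fun u => eq_top_iff.2 fun v _ => ?_⟩
  obtain ⟨X, rfl⟩ := (G.leftInvariant_bijective u).surjective v
  obtain ⟨m, hm⟩ := hL X
  have h2 : X ∈ K n := by
    rw [hn (max n m) (le_max_left n m)]
    exact K.monotone (le_max_right n m) hm
  exact G.flatDistribution.mem_flag.2 ⟨_, h2, rfl⟩

end FlatModel

/-! ### Integrating a graded homomorphism to flat models. -/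

section Morphism

variable {𝔫 𝔪 : Type*} [LieRing 𝔫] [LieAlgebra ℝ 𝔫] [FiniteDimensional ℝ 𝔫]
  [LieRing 𝔪] [LieAlgebra ℝ 𝔪] [FiniteDimensional ℝ 𝔪]
  {H : NegGrading 𝔫} {G : NegGrading 𝔪} {p : 𝔫 →ₗ⁅ℝ⁆ 𝔪}

theorem map_degree (hp : ∀ i, ∀ X ∈ H.piece i, p X ∈ G.piece i) (v : 𝔫) :
    p (H.degree v) = G.degree (p v) := by
  induction v using H.piece_induction with
  | zero => simp
  | add a b ha hb => simp only [map_add, ha, hb]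
  | mem i v hv => rw [H.degree_of_mem hv, G.degree_of_mem (hp i v hv), map_smul]

/-- The recursion uses only brackets and graded projections, both preserved by `p`. -/
theorem map_frameAux (hp : ∀ i, ∀ X ∈ H.piece i, p X ∈ G.piece i) (u v : 𝔫) (s : ℕ) :
    p (H.frameAux u s v) = G.frameAux (p u) s (p v) := by
  induction s using Nat.strong_induction_on with
  | _ s ih =>
  rcases s with _ | s
  · rw [frameAux, frameAux]; rfl
  · simp only [frameAux_succ, LinearMap.smul_apply, LinearMap.sum_apply, LinearMap.comp_apply,
      LieAlgebra.ad_apply, map_smul, map_sum, LieHom.map_lie]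
    congr 1
    refine Finset.sum_congr rfl fun l _ => ?_
    rw [ih _ (by omega)]
    exact congrArg (⁅·, _⁆) (map_proj H G (p := (p : 𝔫 →ₗ[ℝ] 𝔪)) hp (l + 1) u)

theorem map_frame (hp : ∀ i, ∀ X ∈ H.piece i, p X ∈ G.piece i) (u v : 𝔫) :
    p (H.frame u v) = G.frame (p u) (p v) := by
  rw [H.frame_apply u v (le_max_left H.depth G.depth),
    G.frame_apply _ _ (le_max_right H.depth G.depth), map_sum]
  exact Finset.sum_congr rfl fun s _ => map_frameAux hp u v s

/-- The homomorphism of Lie groups that integrates a homomorphism of graded Lie algebras. -/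
noncomputable def flatModelHom (hp : ∀ i, ∀ X ∈ H.piece i, p X ∈ G.piece i) :
    H.FlatModel →* G.FlatModel where
  -- Both groups live on the underlying vector spaces, so no exponential map intervenes;
  -- multiplicativity for `u + A_u v` is `map_frame`.
  toFun := fun u : 𝔫 => p u
  map_one' := map_zero p
  map_mul' := fun (u v : 𝔫) => by
    have h := map_add p u (H.frame u v)
    rw [map_frame hp] at h
    exact h

/-- The map `p : 𝔫 → 𝔪` as a continuous linear map. -/
noncomputable def spaceMap (H : NegGrading 𝔫) (G : NegGrading 𝔪) (p : 𝔫 →ₗ⁅ℝ⁆ 𝔪) :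
    H.Space →L[ℝ] G.Space :=
  LinearMap.toContinuousLinearMap
    (G.toSpace.toLinearMap ∘ₗ (p : 𝔫 →ₗ[ℝ] 𝔪) ∘ₗ H.toSpace.symm.toLinearMap)

theorem contMDiff_flatModelHom (hp : ∀ i, ∀ X ∈ H.piece i, p X ∈ G.piece i) :
    ContMDiff 𝓘(ℝ, H.Space) 𝓘(ℝ, G.Space) ∞ (flatModelHom hp) :=
  (spaceMap H G p).contMDiff

theorem mfderiv_flatModelHom_apply (hp : ∀ i, ∀ X ∈ H.piece i, p X ∈ G.piece i) (u : H.FlatModel)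
    (v : 𝔫) : mfderiv 𝓘(ℝ, H.Space) 𝓘(ℝ, G.Space) (flatModelHom hp) u v = p v :=
  congrArg (fun L : H.Space →L[ℝ] G.Space => L v)
    ((spaceMap H G p).hasMFDerivAt (x := H.toModel.symm u)).mfderiv

/-- The left-invariant field of `X` is `u ↦ A_u (degree X)`; the linear map `p` is its own
derivative and intertwines both `A` and `degree`. -/
theorem mfderiv_flatModelHom_leftInvariant (hp : ∀ i, ∀ X ∈ H.piece i, p X ∈ G.piece i)
    (u : H.FlatModel) (X : 𝔫) :
    mfderiv 𝓘(ℝ, H.Space) 𝓘(ℝ, G.Space) (flatModelHom hp) u (H.leftInvariant u X) =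
      G.leftInvariant (flatModelHom hp u) (p X) := by
  rw [leftInvariant_apply, leftInvariant_apply]
  refine (mfderiv_flatModelHom_apply hp u _).trans ((map_frame hp _ _).trans ?_)
  exact congrArg (G.frame _) (map_degree hp X)

end Morphism

end NegGrading

/-! ### From central extensions to integrable extensions, and the theorem. -/

/-- A central extension of graded nilpotent Lie algebras of pure grading `-k`, `k > 2`, integrates
to an integrable extension of flat models. -/
theorem IsCentralExtension.isIntegrableExtension {𝔫 𝔪 : Type*} [LieRing 𝔫] [LieAlgebra ℝ 𝔫]
    [FiniteDimensional ℝ 𝔫] [LieRing 𝔪] [LieAlgebra ℝ 𝔪] [FiniteDimensional ℝ 𝔪]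
    {H : NegGrading 𝔫} {G : NegGrading 𝔪} {d k : ℕ} {p : 𝔫 →ₗ⁅ℝ⁆ 𝔪}
    (hp : IsCentralExtension H G d k p) (hk : 2 < k) :
    IsIntegrableExtension H.flatDistribution G.flatDistribution
      (NegGrading.flatModelHom hp.map_piece) where
  contMDiff := NegGrading.contMDiff_flatModelHom hp.map_piece
  submersion u := by
    intro w
    obtain ⟨v, hv⟩ := hp.surjective w
    exact ⟨v, (NegGrading.mfderiv_flatModelHom_apply hp.map_piece u v).trans hv⟩
  bijOn u := by
    have hd := NegGrading.mfderiv_flatModelHom_leftInvariant hp.map_piece u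
    refine ⟨?_, ?_, ?_⟩
    · rintro _ ⟨X, hX, rfl⟩
      exact ⟨p X, hp.map_piece 1 X hX, (hd X).symm⟩
    · rintro _ ⟨X, hX, rfl⟩ _ ⟨Y, hY, rfl⟩ h
      rw [hd, hd] at h
      have h1 : p (X - Y) = 0 := by
        rw [map_sub, G.leftInvariant_injective _ h, sub_self]
      -- The difference lies in g_{-1} and in the kernel, which is contained in g_{-k}.
      have h2 := H.eq_zero_of_mem_piece (by omega : 1 ≠ k) (Submodule.sub_mem _ hX hY)
        (hp.ker_le_piece _ ((LieHom.mem_ker (f := p)).2 h1))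
      rw [sub_eq_zero.1 h2]
    · rintro _ ⟨Y, hY, rfl⟩
      obtain ⟨X, rfl⟩ := hp.surjective Y
      -- An arbitrary preimage need not lie in g_{-1}, but its component there has the same image
      -- because `p` is graded.
      refine ⟨_, ⟨H.proj 1 X, H.proj_mem 1 X, rfl⟩, ?_⟩
      rw [hd]
      have h := NegGrading.map_proj H G (p := (p : 𝔫 →ₗ[ℝ] 𝔪)) hp.map_piece 1 X
      exact congrArg _ (h.trans (G.proj_of_mem hY))
  flag_two u := by
    rw [Submodule.disjoint_def]
    intro v hv hv'
    obtain ⟨X, hX, rfl⟩ := H.flatDistribution_flag_two_le u hv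
    have h := (NegGrading.mfderiv_flatModelHom_leftInvariant hp.map_piece u X).symm.trans hv'
    have h1 : p X = 0 := G.leftInvariant_injective _ (h.trans (map_zero _).symm)
    have h2 := hp.ker_le_piece _ ((LieHom.mem_ker (f := p)).2 h1)
    -- An element of g_{-1} + g_{-2} has no component in degree `-k`, as `k > 2`.
    have h3 : X = 0 := by
      obtain ⟨A, hA, B, hB, rfl⟩ := Submodule.mem_sup.1 hX
      rw [← H.proj_of_mem h2, map_add, H.proj_of_mem_ne (by omega) hA,
        H.proj_of_mem_ne (by omega) hB, add_zero]
    rw [h3, map_zero]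

theorem mainTheorem10 :
    (∀ {E' : Type*} [NormedAddCommGroup E'] [NormedSpace ℝ E'] [FiniteDimensional ℝ E']
      {M' : Type*} [TopologicalSpace M'] [ChartedSpace E' M'] [IsManifold 𝓘(ℝ, E') ∞ M'] [T2Space M']
      {E : Type*} [NormedAddCommGroup E] [NormedSpace ℝ E] [FiniteDimensional ℝ E]
      {M : Type*} [TopologicalSpace M] [ChartedSpace E M] [IsManifold 𝓘(ℝ, E) ∞ M] [T2Space M]
      (Δ' : TangentDistribution E' M') (Δ : TangentDistribution E M) (π : M' → M)
      (x : M') (d k : ℕ),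
      Δ.IsRegular → Δ'.IsRegular →
      Δ.IsCompletelyNonholonomic → Δ'.IsCompletelyNonholonomic →
      IsIntegrableExtension Δ' Δ π →
      Module.finrank ℝ (LinearMap.ker (mfderiv 𝓘(ℝ, E') 𝓘(ℝ, E) π x).toLinearMap) = d →
      2 < k →
      LinearMap.ker (mfderiv 𝓘(ℝ, E') 𝓘(ℝ, E) π x).toLinearMap ≤ Δ'.flag k x →
      Disjoint (LinearMap.ker (mfderiv 𝓘(ℝ, E') 𝓘(ℝ, E) π x).toLinearMap) (Δ'.flag (k - 1) x) →
      ∃ p : Δ'.Carnot x →ₗ⁅ℝ⁆ Δ.Carnot (π x),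
        IsCentralExtension (Δ'.carnotGrading x) (Δ.carnotGrading (π x)) d k p ∧
        ∀ (i : ℕ) (X' : Δ'.flagSections i) (X : Δ.flagSections i),
          mfderiv 𝓘(ℝ, E') 𝓘(ℝ, E) π x (X'.1.1 x) = X.1.1 (π x) →
            p (Δ'.cls x i X') = Δ.cls (π x) i X) ∧
    (∀ {𝔫 : Type*} [LieRing 𝔫] [LieAlgebra ℝ 𝔫] [FiniteDimensional ℝ 𝔫]
      {𝔪 : Type*} [LieRing 𝔪] [LieAlgebra ℝ 𝔪] [FiniteDimensional ℝ 𝔪]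
      (H : NegGrading 𝔫) (G : NegGrading 𝔪) (d k : ℕ) (p : 𝔫 →ₗ⁅ℝ⁆ 𝔪),
      G.IsFundamental → IsCentralExtension H G d k p → ¬ IsTrivialExtension p → 2 < k →
      ∃ π : H.FlatModel →* G.FlatModel,
        IsIntegrableExtension H.flatDistribution G.flatDistribution π ∧
        (∀ (u : H.FlatModel) (X : 𝔫),
          mfderiv 𝓘(ℝ, H.Space) 𝓘(ℝ, G.Space) π u (H.leftInvariant u X) =
            G.leftInvariant (π u) (p X)) ∧
        (H.IsFundamental → H.flatDistribution.IsCompletelyNonholonomic)) := by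
  refine ⟨?_, ?_⟩
  · intro E' _ _ _ M' _ _ _ _ E _ _ _ M _ _ _ _ Δ' Δ π x d k hΔ hΔ' _ _ hπ hd hk hle hdis
    exact hπ.exists_isCentralExtension hΔ hΔ' x hd hle hdis
  · intro 𝔫 _ _ _ 𝔪 _ _ _ H G d k p _ hp _ hk
    exact ⟨NegGrading.flatModelHom hp.map_piece, hp.isIntegrableExtension hk,
      NegGrading.mfderiv_flatModelHom_leftInvariant hp.map_piece,
      fun hH => NegGrading.IsFundamental.isCompletelyNonholonomic H hH⟩
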